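/- Let $R$ be a commutative Noetherian ring, $\mathfrak a$ an ideal of $R$, $M$ a finitely generated $R$-module and $r \ge 0$ an integer. Write $H^i_{\mathfrak a}(M) = \varinjlim_n \operatorname{Ext}^i_R(R/\mathfrak a^n, M)$ for the local cohomology modules. An $R$-module $L$ is said to be in dimension $< n$ if it has a finitely generated submodule $L'$ with $\dim \operatorname{Supp}(L/L') < n$, and it is called minimax if it has a finitely generated submodule $L'$ such that $L/L'$ is Artinian. Suppose that there is an integer $t \ge 0$ such that $\mathfrak a^t H^i_{\mathfrak a}(M)$ is in dimension $< 2$ for all $i < r$. Then, for every minimax submodule $N$ of $H^r_{\mathfrak a}(M)$, the $R$-module $\operatorname{Hom}_R(R/\mathfrak a, H^r_{\mathfrak a}(M)/N)$ is finitely generated. In particular, the set $\operatorname{Ass}_R(H^r_{\mathfrak a}(M)/N)$ is finite. -/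

import Mathlib

universe u v

/-- The `i`-th local cohomology module `H^i_a(M) = colim_n Ext^i_R(R/a^n, M)`. -/
noncomputable abbrev localCohomologyModule {R : Type u} [CommRing R] (a : Ideal R) (i : ℕ)
    (M : Type u) [AddCommGroup M] [Module R M] : ModuleCat.{u} R :=
  (localCohomology a i).obj (ModuleCat.of R M)

/-- `M` is in dimension `< n`: some finitely generated submodule `N` satisfies
`dim Supp (M/N) < n` (the dimension of the empty set is `⊥`). -/
def Module.IsInDimensionLT (R : Type u) [CommRing R] (M : Type v) [AddCommGroup M] [Module R M]
    (n : ℕ) : Prop :=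
  ∃ N : Submodule R M, N.FG ∧ Module.supportDim R (M ⧸ N) < (n : WithBot ℕ∞)

/-- `L` is minimax: some finitely generated submodule `N` has Artinian quotient `L/N`. -/
def Module.IsMinimax (R : Type u) [CommRing R] (L : Type v) [AddCommGroup L] [Module R L] : Prop :=
  ∃ N : Submodule R L, N.FG ∧ IsArtinian R (L ⧸ N)

/-! Write Γ(M) for the `a`-power torsion of M and H^i for H^i_a. The heart is that Hom(R/a, H^r(M))
and Ext^1(R/a, H^r(M)) are finitely generated (`localCohomologyModule_extFinite`). This goes by
induction on r over all modules M, finitely generated or not, whose Ext^j(R/a, M) are all finitely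
generated. For r = 0, H^0(M) = Γ(M), and Hom(R/a, M/Γ(M)) = 0 lets Ext^1(R/a, Γ(M)) embed in
Ext^1(R/a, M). For r > 0, Γ(M) has all its Ext modules finitely generated by the cofiniteness
criterion below, hence so does M/Γ(M). The latter embeds in a torsion-free injective E with cokernel
C, and H^{i+1}(M) = H^i(C) (`exists_localCohomology_shift`), so induction applies to C.

The criterion (`Ideal.ExtFinite.of_isInDimensionLT_two`): if T is `a`-power torsion, `a^t T` is in
dimension < 2, and Hom(R/a, T) and Ext^1(R/a, T) are finitely generated, then so are all Ext^j(R/a,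
T). Modulo finitely generated submodules, T has dimension at most 1. One then finds x in `a` such
that, modulo a finitely generated submodule, T/xT has dimension 0. As x kills Ext(R/a, T),
finiteness follows from that for the kernel and cokernel of x
(`Ideal.ExtFinite.of_ker_of_quotient`). The cokernel falls under the dimension 0 case, proved the
same way; the kernel has a larger annihilator and is handled by Noetherian induction. The element x
comes from localizing at minimal primes of the support, where T is Artinian, and avoiding finitely
many primes in the style of secondary representations.

Finally, if N is minimax then Ext^1(R/a, N) is finitely generated by the dimension 0 case, and the
long exact sequence gives Hom(R/a, H^r(M)/N). -/

section

open CategoryTheory Limits Opposite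

/-! ### Cohomology of Hom(P, Y) is `Abelian.Ext`, naturally. -/

namespace CategoryTheory.ProjectiveResolution

variable {R : Type u} [CommRing R] {X X' : ModuleCat.{u} R}

/-- Degree zero has no coboundaries: the resolution, as a cochain complex, sits in degrees ≤ 0, so
its term in degree 1 vanishes. -/
lemma extMk_zero_eq_zero_iff (P : ProjectiveResolution X) {Y : ModuleCat.{u} R}
    (f : P.complex.X 0 ⟶ Y) (hf : P.complex.d 1 0 ≫ f = 0) :
    P.extMk f 1 rfl hf = 0 ↔ f = 0 := by
  constructor
  · intro h
    rw [← P.extEquivCohomologyClass.apply_eq_iff_eq, extEquivCohomologyClass_extMk,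
      extEquivCohomologyClass_zero, CochainComplex.HomComplex.CohomologyClass.mk_eq_zero_iff,
      CochainComplex.HomComplex.Cocycle.toSingleMk_mem_coboundaries_iff _ _ _ _ _ 1
        (by simp)] at h
    obtain ⟨g, hg⟩ := h
    have hz : g = 0 := (CochainComplex.isZero_of_isStrictlyLE P.cochainComplex 0 1).eq_of_src _ _
    rw [hz, comp_zero] at hg
    rw [← cancel_epi (P.cochainComplexXIso (-(0 : ℕ)) 0 rfl).hom, ← hg, comp_zero]
  · rintro rfl
    simp

/-- The `n`-cocycles with values in `Y` of a projective resolution. -/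
noncomputable def cocycles (P : ProjectiveResolution X) (Y : ModuleCat.{u} R) (n : ℕ) :
    Submodule R (P.complex.X n ⟶ Y) :=
  LinearMap.ker (Linear.leftComp R Y (P.complex.d (n + 1) n))

lemma mem_cocycles (P : ProjectiveResolution X) {Y : ModuleCat.{u} R} {n : ℕ}
    (f : P.complex.X n ⟶ Y) : f ∈ P.cocycles Y n ↔ P.complex.d (n + 1) n ≫ f = 0 := Iff.rfl

/-- The class in `Ext` of a cocycle, as a linear map. -/
noncomputable def cocyclesToExt (P : ProjectiveResolution X) (Y : ModuleCat.{u} R) (n : ℕ) :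
    P.cocycles Y n →ₗ[R] Abelian.Ext X Y n where
  toFun z := P.extMk z.1 (n + 1) rfl ((P.mem_cocycles _).1 z.2)
  map_add' x y := by
    rw [add_extMk]
    rfl
  map_smul' r x := by
    rw [Abelian.Ext.smul_eq_comp_mk₀, extMk_comp_mk₀]
    congr 1

lemma cocyclesToExt_surjective (P : ProjectiveResolution X) (Y : ModuleCat.{u} R) (n : ℕ) :
    Function.Surjective (P.cocyclesToExt Y n) := fun α ↦ by
  obtain ⟨f, hf, h⟩ := P.extMk_surjective α (n + 1) rfl
  exact ⟨⟨f, hf⟩, h⟩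

lemma cocyclesToExt_eq_zero_iff (P : ProjectiveResolution X) (Y : ModuleCat.{u} R) (n : ℕ)
    (z : P.cocycles Y n) : P.cocyclesToExt Y n z = 0 ↔
      ∃ g : P.complex.X ((ComplexShape.up ℕ).prev n) ⟶ Y, P.complex.d n _ ≫ g = z.1 := by
  obtain ⟨z, hz⟩ := z
  rw [mem_cocycles] at hz
  change P.extMk z (n + 1) rfl hz = 0 ↔ _
  cases n with
  | zero =>
    refine (P.extMk_zero_eq_zero_iff z hz).trans ?_
    constructor
    · rintro rfl
      exact ⟨0, comp_zero⟩
    · rintro ⟨g, hg⟩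
      -- In `ComplexShape.up ℕ` the predecessor of 0 is 0 itself, and the differential from 0 to 0
      -- is zero.
      exact hg.symm.trans (by rw [P.complex.shape _ _ (by simp), zero_comp])
  | succ n =>
    rw [CochainComplex.prev_nat_succ]
    exact P.extMk_eq_zero_iff _ _ _ _ n rfl

variable (P : ProjectiveResolution X) (Y : ModuleCat.{u} R) (n : ℕ)

/-- The cycles of the complex `Hom(P, Y)` are the cocycles of `P`. -/
noncomputable def cyclesToCocycles :
    (P.complex.linearYonedaObj R Y).cycles n →ₗ[R] P.cocycles Y n :=
  LinearMap.codRestrict (P.cocycles Y n)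
    (((P.complex.linearYonedaObj R Y).iCycles n).hom : _ →ₗ[R] (P.complex.X n ⟶ Y))
    fun z ↦ congr($((P.complex.linearYonedaObj R Y).iCycles_d n (n + 1)) z)

lemma cyclesToCocycles_surjective : Function.Surjective (P.cyclesToCocycles Y n) := by
  intro z
  let k : ModuleCat.of R (P.cocycles Y n) ⟶ (P.complex.linearYonedaObj R Y).X n :=
    ModuleCat.ofHom (P.cocycles Y n).subtype
  have hk : k ≫ (P.complex.linearYonedaObj R Y).d n (n + 1) = 0 := by
    ext w
    exact w.2
  refine ⟨(P.complex.linearYonedaObj R Y).liftCycles k (n + 1) (by simp) hk z, ?_⟩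
  apply Subtype.ext
  exact congr($((P.complex.linearYonedaObj R Y).liftCycles_i k (n + 1) (by simp) hk) z)

/-- The comparison map from the cohomology of `Hom(P, Y)` to `Ext`. -/
noncomputable def homologyToExt :
    (P.complex.linearYonedaObj R Y).homology n ⟶ ModuleCat.of R (Abelian.Ext X Y n) :=
  ((P.complex.linearYonedaObj R Y).homologyIsCokernel _ n rfl).desc
    (CokernelCofork.ofπ (ModuleCat.ofHom (P.cocyclesToExt Y n ∘ₗ P.cyclesToCocycles Y n)) (by
      ext g
      refine (P.cocyclesToExt_eq_zero_iff Y n _).2 ⟨g, ?_⟩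
      exact congr($((P.complex.linearYonedaObj R Y).toCycles_i
        ((ComplexShape.up ℕ).prev n) n) g).symm))

lemma homologyπ_homologyToExt :
    (P.complex.linearYonedaObj R Y).homologyπ n ≫ P.homologyToExt Y n =
      ModuleCat.ofHom (P.cocyclesToExt Y n ∘ₗ P.cyclesToCocycles Y n) :=
  Cofork.IsColimit.π_desc ((P.complex.linearYonedaObj R Y).homologyIsCokernel _ n rfl)

lemma homologyToExt_homologyπ_apply (z : (P.complex.linearYonedaObj R Y).cycles n) :
    P.homologyToExt Y n ((P.complex.linearYonedaObj R Y).homologyπ n z) =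
      P.cocyclesToExt Y n (P.cyclesToCocycles Y n z) :=
  congr($(P.homologyπ_homologyToExt Y n) z)

lemma homologyToExt_bijective : Function.Bijective (P.homologyToExt Y n) := by
  constructor
  · rw [injective_iff_map_eq_zero]
    intro h hh
    obtain ⟨z, rfl⟩ := (ModuleCat.epi_iff_surjective
      ((P.complex.linearYonedaObj R Y).homologyπ n)).1 inferInstance h
    rw [homologyToExt_homologyπ_apply, cocyclesToExt_eq_zero_iff] at hh
    obtain ⟨g, hg⟩ := hh
    have : z = (P.complex.linearYonedaObj R Y).toCycles ((ComplexShape.up ℕ).prev n) n g := by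
      apply (ModuleCat.mono_iff_injective
        ((P.complex.linearYonedaObj R Y).iCycles n)).1 inferInstance
      exact hg.symm.trans (congr($((P.complex.linearYonedaObj R Y).toCycles_i
        ((ComplexShape.up ℕ).prev n) n) g).symm)
    rw [this]
    exact congr($((P.complex.linearYonedaObj R Y).toCycles_comp_homologyπ
      ((ComplexShape.up ℕ).prev n) n) g)
  · intro e
    obtain ⟨z, rfl⟩ := P.cocyclesToExt_surjective Y n e
    obtain ⟨z, rfl⟩ := P.cyclesToCocycles_surjective Y n z
    exact ⟨_, P.homologyToExt_homologyπ_apply Y n z⟩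

instance isIso_homologyToExt : IsIso (P.homologyToExt Y n) :=
  (ConcreteCategory.isIso_iff_bijective _).2 (P.homologyToExt_bijective Y n)

variable {P n}

/-- The morphism of complexes `Hom(P', Y) ⟶ Hom(P, Y)` induced by a morphism `P ⟶ P'`. -/
noncomputable def linearYonedaMap {P' : ProjectiveResolution X'} (φ : P.complex ⟶ P'.complex) :
    P'.complex.linearYonedaObj R Y ⟶ P.complex.linearYonedaObj R Y :=
  (HomologicalComplex.unopFunctor _ _).map
    (((((linearYoneda R _).obj Y).rightOp.mapHomologicalComplex _).map φ).op)

lemma cyclesToCocycles_cyclesMap {P' : ProjectiveResolution X'} (φ : P.complex ⟶ P'.complex)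
    (z : (P'.complex.linearYonedaObj R Y).cycles n) :
    (P.cyclesToCocycles Y n (HomologicalComplex.cyclesMap (linearYonedaMap Y φ) n z)).1 =
      φ.f n ≫ (P'.cyclesToCocycles Y n z).1 :=
  congr($(HomologicalComplex.cyclesMap_i (linearYonedaMap Y φ) n) z)

lemma cocyclesToExt_naturality {P' : ProjectiveResolution X'} {f : X ⟶ X'} (φ : Hom P P' f)
    (z : P.cocycles Y n) (z' : P'.cocycles Y n) (h : z.1 = φ.hom.f n ≫ z'.1) :
    P.cocyclesToExt Y n z = (Abelian.Ext.mk₀ f).comp (P'.cocyclesToExt Y n z') (zero_add n) := by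
  obtain ⟨z, hz⟩ := z
  obtain rfl : z = _ := h
  exact (mk₀_comp_extMk z'.1 (n + 1) rfl ((P'.mem_cocycles _).1 z'.2) φ).symm

lemma homologyToExt_naturality {P' : ProjectiveResolution X'} {f : X ⟶ X'} (φ : Hom P P' f) :
    HomologicalComplex.homologyMap (linearYonedaMap Y φ.hom) n ≫ P.homologyToExt Y n =
      P'.homologyToExt Y n ≫ ModuleCat.ofHom ((Abelian.Ext.mk₀ f).precompOfLinear R Y
        (zero_add n)) := by
  rw [← cancel_epi ((P'.complex.linearYonedaObj R Y).homologyπ n),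
    HomologicalComplex.homologyπ_naturality_assoc, homologyπ_homologyToExt,
    ← Category.assoc ((P'.complex.linearYonedaObj R Y).homologyπ n),
    P'.homologyπ_homologyToExt Y n]
  ext z
  exact cocyclesToExt_naturality Y φ _ _ (cyclesToCocycles_cyclesMap Y φ.hom z)

end CategoryTheory.ProjectiveResolution

end

/-! ### Local cohomology as a colimit of `Abelian.Ext` modules. -/

section

open CategoryTheory Limits Opposite

lemma CategoryTheory.comp_comp_eq_of_commSq {C : Type*} [Category* C] {A A' B B' D D' : C}
    {a : A' ⟶ A} {b : B' ⟶ B} {d : D' ⟶ D} {i : A ⟶ B} {i' : A' ⟶ B'} {j : B ⟶ D} {j' : B' ⟶ D'}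
    (h₁ : a ≫ i = i' ≫ b) (h₂ : b ≫ j = j' ≫ d) : a ≫ i ≫ j = (i' ≫ j') ≫ d := by
  rw [reassoc_of% h₁, h₂, Category.assoc]

namespace CategoryTheory.ProjectiveResolution

variable {R : Type u} [CommRing R] {X X' : ModuleCat.{u} R} (Y : ModuleCat.{u} R) (n : ℕ)

/-- `isoExt` unfolds to the left derived functor isomorphism followed by the interchange of homology
and opposites; the two naturality squares are pasted. -/
lemma isoExt_hom_naturality (P : ProjectiveResolution X) (P' : ProjectiveResolution X')
    {f : X ⟶ X'} (φ : Hom P P' f) :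
    ((Ext R (ModuleCat.{u} R) n).map f.op).app Y ≫ (P.isoExt n Y).hom =
      (P'.isoExt n Y).hom ≫ HomologicalComplex.homologyMap (linearYonedaMap Y φ.hom) n := by
  have h₁ := congrArg Quiver.Hom.unop (P.isoLeftDerivedObj_inv_naturality f P' φ.hom
    (by simpa using φ.hom_f_zero_comp_π_f_zero) ((linearYoneda R _).obj Y).rightOp n)
  have h₂ := congrArg Quiver.Hom.unop (ShortComplex.homologyOpIso_inv_naturality
    ((HomologicalComplex.shortComplexFunctor _ _ n).map (linearYonedaMap Y φ.hom)))
  exact comp_comp_eq_of_commSq h₁ h₂.symm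

end CategoryTheory.ProjectiveResolution

/-- For a fixed module `Y`, the functor `X ↦ Ext^n(X, Y)`. -/
noncomputable def ModuleCat.extContra {R : Type u} [CommRing R] (Y : ModuleCat.{u} R) (n : ℕ) :
    (ModuleCat.{u} R)ᵒᵖ ⥤ ModuleCat.{u} R where
  obj X := ModuleCat.of R (Abelian.Ext X.unop Y n)
  map f := ModuleCat.ofHom ((Abelian.Ext.mk₀ f.unop).precompOfLinear R Y (zero_add n))
  map_id X := by
    ext e
    simp
  map_comp f g := by
    ext e
    simp

/-- The derived functors of `Hom(-, Y)` agree with the `Ext` groups of the derived category. -/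
noncomputable def ModuleCat.extFlipObjIso {R : Type u} [CommRing R] (Y : ModuleCat.{u} R) (n : ℕ) :
    (Ext R (ModuleCat.{u} R) n).flip.obj Y ≅ ModuleCat.extContra Y n :=
  NatIso.ofComponents
    (fun X ↦ (ProjectiveResolution.of X.unop).isoExt n Y ≪≫
      @asIso _ _ _ _ _ (ProjectiveResolution.isIso_homologyToExt
        (ProjectiveResolution.of X.unop) Y n))
    fun {X X'} f ↦ by
      let φ : ProjectiveResolution.Hom (ProjectiveResolution.of X'.unop)
          (ProjectiveResolution.of X.unop) f.unop :=
        ⟨ProjectiveResolution.lift f.unop _ _, ProjectiveResolution.lift_commutes_zero _ _ _⟩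
      exact comp_comp_eq_of_commSq (ProjectiveResolution.isoExt_hom_naturality Y n _ _ φ)
        (ProjectiveResolution.homologyToExt_naturality Y φ)

/-- The system of modules `Ext^i(R/a^n, M)`, whose colimit is the local cohomology of `M`. -/
noncomputable abbrev extPowersDiagram {R : Type u} [CommRing R] (a : Ideal R) (i : ℕ)
    (M : ModuleCat.{u} R) : ℕᵒᵖᵒᵖ ⥤ ModuleCat.{u} R :=
  (localCohomology.ringModIdeals (localCohomology.idealPowersDiagram a)).op ⋙
    ModuleCat.extContra M i

/-- Local cohomology as a colimit of `Ext` groups of the derived category. -/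
noncomputable def localCohomologyIsoColimit {R : Type u} [CommRing R] (a : Ideal R) (i : ℕ)
    (M : ModuleCat.{u} R) :
    (localCohomology a i).obj M ≅ colimit (extPowersDiagram a i M) :=
  colimitObjIsoColimitCompEvaluation
      (localCohomology.diagram (localCohomology.idealPowersDiagram a) i) M ≪≫
    HasColimit.isoOfNatIso (Functor.isoWhiskerLeft
      (localCohomology.ringModIdeals (localCohomology.idealPowersDiagram a)).op
      (ModuleCat.extFlipObjIso M i))

end

/-! ### Exact filtered colimits, power torsion, and H^0. -/

section

open CategoryTheory Limits Opposite

section Colimits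

variable {R : Type u} [CommRing R]

instance : HasExactColimitsOfShape ℕᵒᵖᵒᵖ (ModuleCat.{u} R) := by
  have := AB5OfSize_of_univLE.{0, 0, u, u} (ModuleCat.{u} R)
  infer_instance

lemma CategoryTheory.ShortComplex.exact_of_exact_evaluation {J C : Type*} [Category* J]
    [Category* C] [Abelian C] (S : ShortComplex (J ⥤ C))
    (h : ∀ j, (S.map ((evaluation J C).obj j)).Exact) : S.Exact := by
  rw [ShortComplex.exact_iff_isZero_homology, Functor.isZero_iff]
  intro j
  exact ((ShortComplex.exact_iff_isZero_homology _).1 (h j)).of_iso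
    (S.mapHomologyIso ((evaluation J C).obj j)).symm

lemma ModuleCat.colim_map_exact {F₁ F₂ F₃ : ℕᵒᵖᵒᵖ ⥤ ModuleCat.{u} R} (f : F₁ ⟶ F₂) (g : F₂ ⟶ F₃)
    (h : ∀ n, Function.Exact (f.app n) (g.app n)) :
    Function.Exact (colim.map f) (colim.map g) := by
  have w : f ≫ g = 0 := by
    ext n x
    exact (h n).apply_apply_eq_zero x
  have hS : (ShortComplex.mk f g w).Exact := ShortComplex.exact_of_exact_evaluation _ fun j ↦
    (ShortComplex.ShortExact.moduleCat_exact_iff_function_exact _).2 (h j)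
  exact (ShortComplex.ShortExact.moduleCat_exact_iff_function_exact _).1 (hS.map colim)

/-- Lets elements of the colimit be represented at a finite stage. -/
instance : PreservesFilteredColimitsOfSize.{0, 0} (forget (ModuleCat.{u} R)) :=
  preservesFilteredColimitsOfSize_shrink.{0, u, 0, u} _

end Colimits

section Torsion

variable {R : Type u} [CommRing R] (a : Ideal R) (M : Type v) [AddCommGroup M] [Module R M]

/-- The submodule of elements killed by a power of the ideal `a`. -/
def Submodule.powTorsion : Submodule R M where
  carrier := {m | ∃ n : ℕ, ∀ x ∈ a ^ n, x • m = 0}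
  zero_mem' := ⟨0, by simp⟩
  add_mem' := by
    rintro m m' ⟨n, h⟩ ⟨n', h'⟩
    refine ⟨n + n', fun x hx ↦ ?_⟩
    rw [smul_add, h x (Ideal.pow_le_pow_right (by simp) hx),
      h' x (Ideal.pow_le_pow_right (by simp) hx), add_zero]
  smul_mem' := by
    rintro r m ⟨n, h⟩
    exact ⟨n, fun x hx ↦ by rw [smul_comm, h x hx, smul_zero]⟩

variable {a M}

variable (a M) in
/-- A module is `a`-power torsion if each of its elements is killed by a power of `a`. -/
def Ideal.IsPowTorsion : Prop := ∀ m : M, ∃ n : ℕ, ∀ x ∈ a ^ n, x • m = 0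

lemma Submodule.isPowTorsion_powTorsion : a.IsPowTorsion (powTorsion a M) := by
  rintro ⟨m, n, h⟩
  exact ⟨n, fun x hx ↦ Subtype.ext (h x hx)⟩

lemma Ideal.IsPowTorsion.of_injective {N : Type*} [AddCommGroup N] [Module R N]
    (h : a.IsPowTorsion N) (f : M →ₗ[R] N) (hf : Function.Injective f) : a.IsPowTorsion M := by
  intro m
  obtain ⟨n, hn⟩ := h (f m)
  exact ⟨n, fun x hx ↦ hf (by rw [map_smul, hn x hx, map_zero])⟩

lemma Ideal.IsPowTorsion.of_surjective {N : Type*} [AddCommGroup N] [Module R N]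
    (h : a.IsPowTorsion M) (f : M →ₗ[R] N) (hf : Function.Surjective f) : a.IsPowTorsion N := by
  intro m
  obtain ⟨m, rfl⟩ := hf m
  obtain ⟨n, hn⟩ := h m
  exact ⟨n, fun x hx ↦ by rw [← map_smul, hn x hx, map_zero]⟩

end Torsion

section QuotientHom

variable {R : Type u} [CommRing R] {I : Ideal R} {M : Type v} [AddCommGroup M] [Module R M]

lemma Ideal.Quotient.linearMap_mk (g : (R ⧸ I) →ₗ[R] M) (x : R) :
    g (Ideal.Quotient.mk I x) = x • g 1 := by
  rw [← map_smul, ← Algebra.algebraMap_eq_smul_one, Ideal.Quotient.algebraMap_eq]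

lemma Ideal.Quotient.linearMap_eq_zero (g : (R ⧸ I) →ₗ[R] M) (h : g 1 = 0) : g = 0 := by
  refine LinearMap.ext fun x ↦ ?_
  obtain ⟨x, rfl⟩ := Ideal.Quotient.mk_surjective x
  rw [linearMap_mk, h, smul_zero, LinearMap.zero_apply]

lemma Ideal.Quotient.smul_linearMap_one (g : (R ⧸ I) →ₗ[R] M) {x : R} (hx : x ∈ I) :
    x • g 1 = 0 := by
  rw [← linearMap_mk, Ideal.Quotient.eq_zero_iff_mem.2 hx, map_zero]

end QuotientHom

section LocalCohomology

variable {R : Type u} [CommRing R] (a : Ideal R)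

open Abelian

/-- Evaluation at `1` of the elements of `Ext^0(R/a^n, M)`. -/
noncomputable def extPowersEval (M : ModuleCat.{u} R) :
    extPowersDiagram a 0 M ⟶ (Functor.const _).obj M where
  app n := ModuleCat.ofHom
    { toFun e := (Ext.homEquiv₀ e).hom (1 : R ⧸ a ^ n.unop.unop)
      map_add' e e' := by
        change (Ext.addEquiv₀ (e + e')).hom _ = (Ext.addEquiv₀ e).hom _ + (Ext.addEquiv₀ e').hom _
        rw [map_add]
        rfl
      map_smul' r e := by
        change (Ext.linearEquiv₀ (R := R) (r • e)).hom _ = r • (Ext.linearEquiv₀ (R := R) e).hom _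
        rw [map_smul]
        rfl }
  naturality n n' f := by
    ext e
    obtain ⟨g, rfl⟩ := Ext.homEquiv₀.symm.surjective e
    let q := (localCohomology.ringModIdeals (localCohomology.idealPowersDiagram a)).map f.unop
    have h : Ext.homEquiv₀ ((Ext.mk₀ q).comp (Ext.mk₀ g) (zero_add 0)) = q ≫ g := by
      rw [Ext.mk₀_comp_mk₀]
      exact Equiv.apply_symm_apply _ _
    refine congr(($h).hom (1 : R ⧸ a ^ n'.unop.unop)).trans ?_
    exact congr(($(Ext.homEquiv₀.apply_symm_apply g)).hom (1 : R ⧸ a ^ n.unop.unop)).symm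

/-- The canonical map from `H^0_a(M)` to `M`. -/
noncomputable def localCohomologyZeroMap (M : ModuleCat.{u} R) :
    colimit (extPowersDiagram a 0 M) ⟶ M :=
  colimit.desc _ ⟨M, extPowersEval a M⟩

lemma localCohomologyZeroMap_ι (M : ModuleCat.{u} R) (n) (g : _ ⟶ M) :
    localCohomologyZeroMap a M (colimit.ι (extPowersDiagram a 0 M) n (Ext.mk₀ g)) =
      g.hom (1 : R ⧸ a ^ n.unop.unop) := by
  have h := colimit.ι_desc (⟨M, extPowersEval a M⟩ : Cocone (extPowersDiagram a 0 M)) n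
  refine congr($h (Ext.mk₀ g)).trans ?_
  exact congr(($(Ext.homEquiv₀.apply_symm_apply g)).hom (1 : R ⧸ a ^ n.unop.unop))

lemma localCohomologyZeroMap_injective (M : ModuleCat.{u} R) :
    Function.Injective (localCohomologyZeroMap a M) := by
  rw [injective_iff_map_eq_zero]
  intro z hz
  obtain ⟨n, e, rfl⟩ := Concrete.colimit_exists_rep _ z
  obtain ⟨g, rfl⟩ := Ext.homEquiv₀.symm.surjective e
  have h1 : g.hom (1 : R ⧸ a ^ n.unop.unop) = 0 :=
    (localCohomologyZeroMap_ι a M n g).symm.trans hz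
  have : g = 0 := ModuleCat.hom_ext
    (Ideal.Quotient.linearMap_eq_zero (I := a ^ n.unop.unop) g.hom h1)
  subst this
  change colimit.ι (extPowersDiagram a 0 M) n (Ext.mk₀ 0) = 0
  rw [Ext.mk₀_zero]
  exact map_zero _

lemma range_localCohomologyZeroMap (M : ModuleCat.{u} R) :
    LinearMap.range (localCohomologyZeroMap a M).hom = Submodule.powTorsion a M := by
  ext m
  constructor
  · rintro ⟨z, rfl⟩
    obtain ⟨n, e, rfl⟩ := Concrete.colimit_exists_rep _ z
    obtain ⟨g, rfl⟩ := Ext.homEquiv₀.symm.surjective e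
    refine ⟨n.unop.unop, fun x hx ↦ ?_⟩
    have h := localCohomologyZeroMap_ι a M n g
    refine (congrArg (x • ·) h).trans ?_
    exact Ideal.Quotient.smul_linearMap_one (I := a ^ n.unop.unop) g.hom hx
  · rintro ⟨n, hn⟩
    let g : ModuleCat.of R (R ⧸ a ^ n) ⟶ M :=
      ModuleCat.ofHom ((a ^ n).liftQ (LinearMap.toSpanSingleton R M m) fun x hx ↦ hn x hx)
    refine ⟨colimit.ι (extPowersDiagram a 0 M) (op (op n)) (Ext.mk₀ g), ?_⟩
    refine (localCohomologyZeroMap_ι a M (op (op n)) g).trans ?_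
    exact one_smul R m

end LocalCohomology

end

/-! ### The long exact sequence of local cohomology. -/

section

open CategoryTheory Limits Opposite Abelian

section LongExactSequence

variable {R : Type u} [CommRing R] (a : Ideal R)

/-- The colimit of the modules `Ext^i(R/a^n, M)`. -/
noncomputable abbrev extPowersColimit (i : ℕ) (M : ModuleCat.{u} R) : ModuleCat.{u} R :=
  colimit (extPowersDiagram a i M)

/-- Composition with a fixed extension class. -/
noncomputable def extPowersPostcomp {Y Z : ModuleCat.{u} R} {k : ℕ} (β : Ext Y Z k) {i j : ℕ}
    (h : i + k = j) : extPowersDiagram a i Y ⟶ extPowersDiagram a j Z where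
  app n := ModuleCat.ofHom (β.postcompOfLinear R _ h)
  naturality n n' f := by
    ext e
    exact Ext.comp_assoc _ _ _ (zero_add i) h (by lia)

variable {S : ShortComplex (ModuleCat.{u} R)}

lemma extPowersColimit_exact₂ (hS : S.ShortExact) (i : ℕ) :
    Function.Exact (colim.map (extPowersPostcomp a (Ext.mk₀ S.f) (add_zero i)))
      (colim.map (extPowersPostcomp a (Ext.mk₀ S.g) (add_zero i))) :=
  ModuleCat.colim_map_exact _ _ fun n ↦ (ShortComplex.ab_exact_iff_function_exact _).1
    (Ext.covariant_sequence_exact₂' (unop ((localCohomology.ringModIdeals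
      (localCohomology.idealPowersDiagram a)).op.obj n)) hS i)

lemma extPowersColimit_exact₃ (hS : S.ShortExact) (i : ℕ) :
    Function.Exact (colim.map (extPowersPostcomp a (Ext.mk₀ S.g) (add_zero i)))
      (colim.map (extPowersPostcomp a hS.extClass (rfl : i + 1 = _))) :=
  ModuleCat.colim_map_exact _ _ fun n ↦ (ShortComplex.ab_exact_iff_function_exact _).1
    (Ext.covariant_sequence_exact₃' (unop ((localCohomology.ringModIdeals
      (localCohomology.idealPowersDiagram a)).op.obj n)) hS i _ rfl)

lemma extPowersColimit_exact₁ (hS : S.ShortExact) (i : ℕ) :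
    Function.Exact (colim.map (extPowersPostcomp a hS.extClass (rfl : i + 1 = _)))
      (colim.map (extPowersPostcomp a (Ext.mk₀ S.f) (add_zero (i + 1)))) :=
  ModuleCat.colim_map_exact _ _ fun n ↦ (ShortComplex.ab_exact_iff_function_exact _).1
    (Ext.covariant_sequence_exact₁' (unop ((localCohomology.ringModIdeals
      (localCohomology.idealPowersDiagram a)).op.obj n)) hS i _ rfl)

lemma nonempty_extPowersColimit_equiv_succ (hS : S.ShortExact) (i : ℕ)
    (h : Subsingleton (extPowersColimit a i S.X₂))
    (h' : Subsingleton (extPowersColimit a (i + 1) S.X₂)) :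
    Nonempty (extPowersColimit a (i + 1) S.X₁ ≃ₗ[R] extPowersColimit a i S.X₃) := by
  refine ⟨(LinearEquiv.ofBijective
    (colim.map (extPowersPostcomp a hS.extClass (rfl : i + 1 = _))).hom ⟨?_, ?_⟩).symm⟩
  · refine (injective_iff_map_eq_zero _).2 fun x hx ↦ ?_
    obtain ⟨y, rfl⟩ := (extPowersColimit_exact₃ a hS i x).1 hx
    rw [Subsingleton.elim (α := extPowersColimit a i S.X₂) y 0]
    exact map_zero _
  · exact fun x ↦ (extPowersColimit_exact₁ a hS i x).1
      (Subsingleton.elim (α := extPowersColimit a (i + 1) S.X₂) _ _)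

lemma nonempty_extPowersColimit_equiv (hS : S.ShortExact) (i : ℕ)
    (h : Subsingleton (extPowersColimit a i S.X₁))
    (h' : Subsingleton (extPowersColimit a (i + 1) S.X₁)) :
    Nonempty (extPowersColimit a i S.X₂ ≃ₗ[R] extPowersColimit a i S.X₃) := by
  refine ⟨LinearEquiv.ofBijective
    (colim.map (extPowersPostcomp a (Ext.mk₀ S.g) (add_zero i))).hom ⟨?_, ?_⟩⟩
  · refine (injective_iff_map_eq_zero _).2 fun x hx ↦ ?_
    obtain ⟨y, rfl⟩ := (extPowersColimit_exact₂ a hS i x).1 hx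
    rw [Subsingleton.elim (α := extPowersColimit a i S.X₁) y 0]
    exact map_zero _
  · exact fun x ↦ (extPowersColimit_exact₃ a hS i x).1
      (Subsingleton.elim (α := extPowersColimit a (i + 1) S.X₁) _ _)

/-- The connecting map is onto because the next term vanishes, and zero because the preceding map is
surjective. -/
lemma subsingleton_extPowersColimit_succ (hS : S.ShortExact) (i : ℕ)
    (h : Function.Surjective
      (colim.map (extPowersPostcomp a (Ext.mk₀ S.g) (add_zero i))))
    (h' : Subsingleton (extPowersColimit a (i + 1) S.X₂)) :
    Subsingleton (extPowersColimit a (i + 1) S.X₁) := by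
  refine subsingleton_of_forall_eq 0 fun x ↦ ?_
  obtain ⟨y, rfl⟩ := (extPowersColimit_exact₁ a hS i x).1
    (Subsingleton.elim (α := extPowersColimit a (i + 1) S.X₂) _ _)
  obtain ⟨z, rfl⟩ := h y
  exact (extPowersColimit_exact₃ a hS i).apply_apply_eq_zero z

lemma subsingleton_extPowersColimit_of_injective (i : ℕ) (E : ModuleCat.{u} R) [Injective E] :
    Subsingleton (extPowersColimit a (i + 1) E) := by
  refine subsingleton_of_forall_eq 0 fun x ↦ ?_
  obtain ⟨n, e, rfl⟩ := Concrete.colimit_exists_rep _ x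
  rw [show e = 0 from Ext.eq_zero_of_injective _]
  exact map_zero _

lemma localCohomologyZeroMap_naturality {M N : ModuleCat.{u} R} (g : M ⟶ N) :
    colim.map (extPowersPostcomp a (Ext.mk₀ g) (add_zero 0)) ≫ localCohomologyZeroMap a N =
      localCohomologyZeroMap a M ≫ g := by
  ext z
  obtain ⟨n, e, rfl⟩ := Concrete.colimit_exists_rep _ z
  obtain ⟨f, rfl⟩ := Ext.homEquiv₀.symm.surjective e
  refine Eq.trans ?_ (congrArg g (localCohomologyZeroMap_ι a M n f)).symm
  have h₁ : colim.map (extPowersPostcomp a (Ext.mk₀ g) (add_zero 0))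
      (colimit.ι (extPowersDiagram a 0 M) n (Ext.mk₀ f)) =
      colimit.ι (extPowersDiagram a 0 N) n (Ext.mk₀ (f ≫ g)) := by
    refine congr($(colimit.ι_map (extPowersPostcomp a (Ext.mk₀ g) (add_zero 0)) n)
      (Ext.mk₀ f)).trans ?_
    rw [← Ext.mk₀_comp_mk₀]
    rfl
  exact (congrArg (localCohomologyZeroMap a N) h₁).trans (localCohomologyZeroMap_ι a N n (f ≫ g))

lemma colim_map_extPowersPostcomp_surjective {M N : ModuleCat.{u} R} (g : M ⟶ N)
    (hg : Function.Surjective g) (hM : a.IsPowTorsion M) :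
    Function.Surjective (colim.map (extPowersPostcomp a (Ext.mk₀ g) (add_zero 0))) := by
  intro y
  obtain ⟨m, hm⟩ := hg (localCohomologyZeroMap a N y)
  obtain ⟨x, hx⟩ : m ∈ LinearMap.range (localCohomologyZeroMap a M).hom := by
    rw [range_localCohomologyZeroMap]
    exact hM m
  refine ⟨x, localCohomologyZeroMap_injective a N ?_⟩
  refine congr($(localCohomologyZeroMap_naturality a g) x).trans ?_
  exact (congrArg g hx).trans hm

end LongExactSequence

end

/-! ### Torsion of injectives and dimension shifting. -/

section

open CategoryTheory Limits Opposite Abelian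

section InjectiveTorsion

variable {R : Type u} [CommRing R] (a : Ideal R)

lemma Ideal.IsPowTorsion.exists_pow_forall_mem {M : Type v} [AddCommGroup M] [Module R M]
    {a : Ideal R} (N : Submodule R M) (hN : N.FG) (h : a.IsPowTorsion N) :
    ∃ n : ℕ, ∀ x ∈ a ^ n, ∀ m ∈ N, x • m = 0 := by
  induction N, hN using Submodule.fg_induction with
  | singleton m =>
    obtain ⟨n, hn⟩ := h ⟨m, Submodule.mem_span_singleton_self m⟩
    refine ⟨n, fun x hx y hy ↦ ?_⟩
    obtain ⟨r, rfl⟩ := Submodule.mem_span_singleton.1 hy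
    rw [smul_comm, show x • m = 0 from congrArg Subtype.val (hn x hx), smul_zero]
  | sup N₁ N₂ _ _ h₁ h₂ =>
    obtain ⟨n₁, hn₁⟩ := h₁ (h.of_injective (Submodule.inclusion le_sup_left)
      (Submodule.inclusion_injective _))
    obtain ⟨n₂, hn₂⟩ := h₂ (h.of_injective (Submodule.inclusion le_sup_right)
      (Submodule.inclusion_injective _))
    refine ⟨n₁ + n₂, fun x hx m hm ↦ ?_⟩
    obtain ⟨m₁, hm₁, m₂, hm₂, rfl⟩ := Submodule.mem_sup.1 hm
    rw [smul_add, hn₁ x (Ideal.pow_le_pow_right (by simp) hx) m₁ hm₁,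
      hn₂ x (Ideal.pow_le_pow_right (by simp) hx) m₂ hm₂, add_zero]

/-- Baer's criterion and Artin–Rees. The image of g : I → Γ(E) is killed by some `a^n`, and I ∩
`a^(n+k)` ⊆ `a^n I`, so g factors through the image of I in R/`a^(n+k)`. It extends from there to E,
and any map out of R/`a^(n+k)` lands in Γ(E). -/
lemma Submodule.powTorsion_injective [IsNoetherianRing R] (E : Type u) [AddCommGroup E]
    [Module R E] [Module.Injective R E] : Module.Injective R (Submodule.powTorsion a E) := by
  refine Module.Baer.injective fun I g ↦ ?_
  obtain ⟨n, hn⟩ := Ideal.IsPowTorsion.exists_pow_forall_mem (a := a) (LinearMap.range g)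
    (Module.Finite.fg_top (R := R) (M := I) |>.map g |> fun h ↦ by
      rwa [← LinearMap.range_eq_map] at h)
    ((Submodule.isPowTorsion_powTorsion (a := a) (M := E)).of_injective
      (LinearMap.range g).subtype Subtype.val_injective)
  obtain ⟨k, hk⟩ := Ideal.exists_pow_inf_eq_pow_smul a I
  let f : I →ₗ[R] R ⧸ a ^ (n + k) := (a ^ (n + k)).mkQ ∘ₗ I.subtype
  have hfg : LinearMap.ker f ≤ LinearMap.ker ((powTorsion a E).subtype ∘ₗ g) := by
    rintro ⟨x, hxI⟩ hx
    have hxa : x ∈ a ^ (n + k) := (Submodule.Quotient.mk_eq_zero _).1 hx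
    have hx' : x ∈ a ^ n • (I : Submodule R R) := by
      have h1 := hk (n + k) (Nat.le_add_left _ _)
      have h2 : x ∈ a ^ (n + k) • (⊤ : Submodule R R) ⊓ I := ⟨by simpa using hxa, hxI⟩
      rw [h1, Nat.add_sub_cancel] at h2
      exact Submodule.smul_mono le_rfl inf_le_right h2
    have key : ∀ y (hy : y ∈ a ^ n • (I : Submodule R R)),
        ∃ hyI : y ∈ I, g ⟨y, hyI⟩ = 0 := by
      intro y hy
      refine Submodule.smul_induction_on hy ?_ ?_
      · intro r hr z hz
        refine ⟨I.smul_mem r hz, ?_⟩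
        have : (⟨r • z, I.smul_mem r hz⟩ : I) = r • ⟨z, hz⟩ := rfl
        rw [this, map_smul]
        exact hn r hr _ ⟨_, rfl⟩
      · rintro y z ⟨hy, hy'⟩ ⟨hz, hz'⟩
        refine ⟨I.add_mem hy hz, ?_⟩
        have : (⟨y + z, I.add_mem hy hz⟩ : I) = ⟨y, hy⟩ + ⟨z, hz⟩ := rfl
        rw [this, map_add, hy', hz', add_zero]
    obtain ⟨_, h⟩ := key x hx'
    simp [h]
  obtain ⟨h, hh⟩ := Module.Injective.out ((LinearMap.ker f).liftQ f le_rfl)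
    (LinearMap.ker_eq_bot.1 (Submodule.ker_liftQ_eq_bot _ _ _ le_rfl))
    ((LinearMap.ker f).liftQ _ hfg)
  refine ⟨LinearMap.codRestrict _ (h ∘ₗ (a ^ (n + k)).mkQ) fun r ↦ ⟨n + k, fun x hx ↦ ?_⟩, ?_⟩
  · rw [← map_smul, LinearMap.comp_apply,
      show (a ^ (n + k)).mkQ (x • r) = 0 from
        (Submodule.Quotient.mk_eq_zero _).2 (Ideal.mul_mem_right r _ hx), map_zero]
  · intro x hx
    exact Subtype.ext (hh ((LinearMap.ker f).mkQ ⟨x, hx⟩))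

/-- An injective submodule splits off, so the quotient is a retract of E. -/
lemma Module.Injective.quotient (E : Type u) [AddCommGroup E] [Module R E]
    [Module.Injective R E] (N : Submodule R E) [Module.Injective R N] :
    Module.Injective R (E ⧸ N) := by
  obtain ⟨ρ, hρ⟩ := Module.Injective.out N.subtype Subtype.val_injective LinearMap.id
  let s : E ⧸ N →ₗ[R] E := N.liftQ (LinearMap.id - N.subtype ∘ₗ ρ) fun x hx ↦ by
    have := hρ ⟨x, hx⟩
    simp only [Submodule.subtype_apply, LinearMap.id_apply] at this
    simp [this]
  have hs (x) : N.mkQ (s x) = x := by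
    obtain ⟨x, rfl⟩ := N.mkQ_surjective x
    simp [s]
  refine ⟨fun X Y _ _ _ _ f hf g ↦ ?_⟩
  obtain ⟨h, hh⟩ := Module.Injective.out f hf (s ∘ₗ g)
  exact ⟨N.mkQ ∘ₗ h, fun x ↦ by rw [LinearMap.comp_apply, hh, LinearMap.comp_apply, hs]⟩

/-- If `a^n x` lies in the torsion it is killed by one power `a^k`, being finitely generated; then
`a^(k+n)` kills x. -/
lemma Submodule.powTorsion_quotient_eq_bot [IsNoetherianRing R] (M : Type v) [AddCommGroup M]
    [Module R M] :
    powTorsion a (M ⧸ powTorsion a M) = ⊥ := by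
  rw [eq_bot_iff]
  rintro x ⟨n, hn⟩
  obtain ⟨x, rfl⟩ := (powTorsion a M).mkQ_surjective x
  refine (Submodule.Quotient.mk_eq_zero _).2 ?_
  obtain ⟨k, hk⟩ := Ideal.IsPowTorsion.exists_pow_forall_mem (a := a)
    (Submodule.map (LinearMap.toSpanSingleton R M x) (a ^ n))
    ((IsNoetherian.noetherian (a ^ n)).map _)
    ((isPowTorsion_powTorsion (a := a) (M := M)).of_injective (Submodule.inclusion (by
      rintro _ ⟨r, hr, rfl⟩
      exact (Submodule.Quotient.mk_eq_zero _).1 (hn r hr))) (Submodule.inclusion_injective _))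
  refine ⟨k + n, fun y hy ↦ ?_⟩
  rw [pow_add] at hy
  refine Submodule.mul_induction_on hy ?_ ?_
  · intro r hr s hs
    rw [mul_smul]
    exact hk r hr _ ⟨s, hs, rfl⟩
  · intro r s hr hs
    rw [add_smul, hr, hs, add_zero]

end InjectiveTorsion

section Interface

variable {R : Type u} [CommRing R] (a : Ideal R)

lemma nonempty_localCohomologyModule_zero_equiv (M : Type u) [AddCommGroup M] [Module R M] :
    Nonempty (localCohomologyModule a 0 M ≃ₗ[R] Submodule.powTorsion a M) :=
  ⟨(localCohomologyIsoColimit a 0 (ModuleCat.of R M)).toLinearEquiv ≪≫ₗ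
    (LinearEquiv.ofInjective (localCohomologyZeroMap a (ModuleCat.of R M)).hom
      (localCohomologyZeroMap_injective a (ModuleCat.of R M))) ≪≫ₗ
    LinearEquiv.ofEq _ _ (range_localCohomologyZeroMap a (ModuleCat.of R M))⟩

lemma Submodule.shortExact_mkQ {B : Type u} [AddCommGroup B] [Module R B] (N : Submodule R B) :
    (ModuleCat.shortComplexOfCompEqZero N.subtype N.mkQ
      (LinearMap.exact_subtype_mkQ N).linearMap_comp_eq_zero).ShortExact :=
  ModuleCat.shortComplex_shortExact _ (LinearMap.exact_subtype_mkQ N) N.injective_subtype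
    N.mkQ_surjective

lemma LinearMap.shortExact_mkQ {A B : Type u} [AddCommGroup A] [Module R A] [AddCommGroup B]
    [Module R B] (f : A →ₗ[R] B) (hf : Function.Injective f) :
    (ModuleCat.shortComplexOfCompEqZero f (LinearMap.range f).mkQ
      (LinearMap.range_mkQ_comp f)).ShortExact :=
  ModuleCat.shortComplex_shortExact _ (LinearMap.exact_map_mkQ_range f) hf
    (Submodule.mkQ_surjective _)

lemma exists_injective_embedding (M : Type u) [AddCommGroup M] [Module R M] :
    ∃ (E : Type u) (_ : AddCommGroup E) (_ : Module R E) (f : M →ₗ[R] E),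
      Module.Injective R E ∧ Function.Injective f :=
  ⟨(Injective.under (ModuleCat.of R M) : ModuleCat.{u} R), inferInstance, inferInstance,
    (Injective.ι (ModuleCat.of R M)).hom,
    (Module.injective_iff_injective_object R _).2
      (inferInstanceAs (Injective (Injective.under (ModuleCat.of R M)))),
    (ModuleCat.mono_iff_injective _).1 inferInstance⟩

variable [IsNoetherianRing R]

lemma Ideal.IsPowTorsion.exists_injective_embedding {a : Ideal R} {T : Type u} [AddCommGroup T]
    [Module R T] (hT : a.IsPowTorsion T) :
    ∃ (E : Type u) (_ : AddCommGroup E) (_ : Module R E) (f : T →ₗ[R] E),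
      Module.Injective R E ∧ Function.Injective f ∧ a.IsPowTorsion E := by
  obtain ⟨E, _, _, f, _, hf⟩ := _root_.exists_injective_embedding (R := R) T
  exact ⟨Submodule.powTorsion a E, inferInstance, inferInstance,
    LinearMap.codRestrict _ f fun t ↦ by
      obtain ⟨n, hn⟩ := hT t
      exact ⟨n, fun x hx ↦ by rw [← map_smul, hn x hx, map_zero]⟩,
    Submodule.powTorsion_injective a E, fun x y h ↦ hf (congrArg Subtype.val h),
    Submodule.isPowTorsion_powTorsion⟩

/-- Embed T in a torsion injective E. The quotient E/T is again torsion, so H^0(E) → H^0(E/T) is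
onto, which gives degree one; higher degrees follow by dimension shifting. -/
lemma subsingleton_extPowersColimit_of_isPowTorsion (i : ℕ) (T : Type u) [AddCommGroup T]
    [Module R T] (hT : a.IsPowTorsion T) :
    Subsingleton (extPowersColimit a (i + 1) (ModuleCat.of R T)) := by
  induction i generalizing T with
  | zero =>
    obtain ⟨E, _, _, f, _, hf, hE⟩ := hT.exists_injective_embedding
    have : Injective (ModuleCat.of R E) :=
      (Module.injective_iff_injective_object R _).1 inferInstance
    exact subsingleton_extPowersColimit_succ a (f.shortExact_mkQ hf) 0
      (colim_map_extPowersPostcomp_surjective a _ (Submodule.mkQ_surjective _) hE)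
      (subsingleton_extPowersColimit_of_injective a 0 _)
  | succ i ih =>
    obtain ⟨E, _, _, f, _, hf, hE⟩ := hT.exists_injective_embedding
    have : Injective (ModuleCat.of R E) :=
      (Module.injective_iff_injective_object R _).1 inferInstance
    have := ih _ (hE.of_surjective _ (LinearMap.range f).mkQ_surjective)
    exact subsingleton_extPowersColimit_succ a (f.shortExact_mkQ hf) (i + 1)
      (fun x ↦ ⟨0, Subsingleton.elim (α := extPowersColimit a (i + 1) (ModuleCat.of R
        (E ⧸ LinearMap.range f))) _ _⟩)
      (subsingleton_extPowersColimit_of_injective a (i + 1) _)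

/-- If M embeds in an injective E₀, then E = E₀/Γ(E₀) is injective and torsion-free, so all its
local cohomology vanishes. Passing from M to M/Γ(M) does not change positive degrees, and M/Γ(M)
embeds in E. -/
theorem exists_localCohomology_shift (M : Type u) [AddCommGroup M] [Module R M] :
    ∃ (E : Type u) (_ : AddCommGroup E) (_ : Module R E)
      (f : (M ⧸ Submodule.powTorsion a M) →ₗ[R] E), Module.Injective R E ∧ Function.Injective f ∧
      Submodule.powTorsion a E = ⊥ ∧ ∀ i, Nonempty
        (localCohomologyModule a (i + 1) M ≃ₗ[R]
          localCohomologyModule a i (E ⧸ LinearMap.range f)) := by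
  obtain ⟨E, _, _, f, _, hf⟩ := exists_injective_embedding (R := R) M
  have := Submodule.powTorsion_injective a E
  have hE := Module.Injective.quotient E (Submodule.powTorsion a E)
  have hbot := Submodule.powTorsion_quotient_eq_bot a E
  have hcomap : Submodule.powTorsion a M = (Submodule.powTorsion a E).comap f := by
    ext m
    refine exists_congr fun n ↦ forall₂_congr fun x hx ↦ ?_
    rw [← map_smul, map_eq_zero_iff f hf]
  let f' := (Submodule.powTorsion a M).mapQ (Submodule.powTorsion a E) f hcomap.le
  have hf' : Function.Injective f' := by
    rw [← LinearMap.ker_eq_bot, Submodule.ker_mapQ, ← hcomap, Submodule.mkQ_map_self]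
  refine ⟨E ⧸ Submodule.powTorsion a E, inferInstance, inferInstance, f', hE, hf', hbot,
    fun i ↦ ?_⟩
  have : Injective (ModuleCat.of R (E ⧸ Submodule.powTorsion a E)) :=
    (Module.injective_iff_injective_object R _).1 inferInstance
  have hT := fun i ↦ subsingleton_extPowersColimit_of_isPowTorsion a i
    (Submodule.powTorsion a M) Submodule.isPowTorsion_powTorsion
  obtain ⟨e₁⟩ := nonempty_extPowersColimit_equiv a
    (Submodule.powTorsion a M).shortExact_mkQ (i + 1) (hT i) (hT (i + 1))
  have h0 : ∀ i, Subsingleton (extPowersColimit a i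
      (ModuleCat.of R (E ⧸ Submodule.powTorsion a E))) := by
    rintro (_ | i)
    · refine subsingleton_of_forall_eq 0 fun x ↦ localCohomologyZeroMap_injective a _ ?_
      have : localCohomologyZeroMap a _ x ∈ LinearMap.range (localCohomologyZeroMap a _).hom :=
        ⟨x, rfl⟩
      rw [range_localCohomologyZeroMap, hbot, Submodule.mem_bot] at this
      rw [this, map_zero]
    · exact subsingleton_extPowersColimit_of_injective a i _
  obtain ⟨e₂⟩ := nonempty_extPowersColimit_equiv_succ a (f'.shortExact_mkQ hf') i (h0 i)
    (h0 (i + 1))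
  exact ⟨(localCohomologyIsoColimit a (i + 1) (ModuleCat.of R M)).toLinearEquiv ≪≫ₗ e₁ ≪≫ₗ e₂ ≪≫ₗ
    (localCohomologyIsoColimit a i (ModuleCat.of R _)).toLinearEquiv.symm⟩

end Interface

end

/-! ### Melkersson's criterion for Artinian modules. -/

section ArtinianOfTorsion

variable {S : Type u} [CommRing S] {T : Type v} [AddCommGroup T] [Module S T]

/-- The elements killed by `x` that are of the form `x ^ k • w` with `w ∈ W`. -/
def Submodule.leadingSocle (x : S) (W : Submodule S T) (k : ℕ) :
    Submodule S (Submodule.torsionBy S T x) :=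
  (W.map (LinearMap.lsmul S T (x ^ k))).comap (Submodule.torsionBy S T x).subtype

lemma Submodule.leadingSocle_mono {x : S} {W W' : Submodule S T} (h : W ≤ W') {k k' : ℕ}
    (hk : k ≤ k') : W.leadingSocle x k' ≤ W'.leadingSocle x k := by
  rintro t ⟨w, hw, e⟩
  refine ⟨x ^ (k' - k) • w, h (W.smul_mem _ hw), ?_⟩
  rw [← e, LinearMap.lsmul_apply, LinearMap.lsmul_apply, smul_smul, ← pow_add,
    Nat.add_sub_cancel' hk]

/-- If `x ^ (n + 1)` kills w, then `x ^ n • w` equals `x ^ n • w'` for some w' in `W'`, and `w - w'`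
is killed by `x ^ n`. -/
lemma Submodule.le_of_leadingSocle_le {x : S} (hx : ∀ t : T, ∃ n : ℕ, x ^ n • t = 0)
    {W W' : Submodule S T} (hW : W' ≤ W) (h : ∀ k, W.leadingSocle x k ≤ W'.leadingSocle x k) :
    W ≤ W' := by
  suffices H : ∀ n : ℕ, ∀ w ∈ W, x ^ n • w = 0 → w ∈ W' from fun w hw ↦ by
    obtain ⟨n, hn⟩ := hx w
    exact H n w hw hn
  intro n
  induction n with
  | zero =>
    intro w _ h0
    rw [pow_zero, one_smul] at h0
    exact h0 ▸ W'.zero_mem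
  | succ n ih =>
    intro w hw h0
    obtain ⟨w', hw', e⟩ := h n (x := ⟨x ^ n • w, by
      rw [Submodule.mem_torsionBy_iff, smul_smul, ← pow_succ', h0]⟩) ⟨w, hw, rfl⟩
    have := ih (w - w') (W.sub_mem hw (hW hw')) (by
      rw [smul_sub, sub_eq_zero]
      exact e.symm)
    simpa using W'.add_mem this hw'

/-- The modules `leadingSocle x k` of the j-th term of a chain decrease in both j and k. The
diagonal stabilizes at some N, and so does each of the finitely many rows k < N. -/
lemma isArtinian_of_torsionBy {x : S} (hx : ∀ t : T, ∃ n : ℕ, x ^ n • t = 0)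
    [IsArtinian S (Submodule.torsionBy S T x)] : IsArtinian S T := by
  rw [← monotone_stabilizes_iff_artinian]
  intro f
  have hf : ∀ {i j}, i ≤ j → OrderDual.ofDual (f j) ≤ OrderDual.ofDual (f i) :=
    fun h ↦ f.monotone h
  have stab := (monotone_stabilizes_iff_artinian (R := S)
    (M := Submodule.torsionBy S T x)).2 inferInstance
  obtain ⟨N, hN⟩ := stab ⟨fun j ↦ OrderDual.toDual ((OrderDual.ofDual (f j)).leadingSocle x j),
    fun i j h ↦ Submodule.leadingSocle_mono (hf h) h⟩
  choose g hg using fun k ↦ stab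
    ⟨fun j ↦ OrderDual.toDual ((OrderDual.ofDual (f j)).leadingSocle x k),
      fun i j h ↦ Submodule.leadingSocle_mono (hf h) le_rfl⟩
  refine ⟨N + ∑ k ∈ Finset.range N, g k, fun m hm ↦ ?_⟩
  refine le_antisymm (f.monotone hm) ?_
  refine Submodule.le_of_leadingSocle_le hx (hf hm) fun k ↦ ?_
  rcases lt_or_ge k N with hk | hk
  · have h1 : g k ≤ N + ∑ k ∈ Finset.range N, g k :=
      (Finset.single_le_sum (fun _ _ ↦ Nat.zero_le _) (Finset.mem_range.2 hk)).trans
        (Nat.le_add_left _ _)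
    exact ((hg k _ h1).symm.trans (hg k _ (h1.trans hm))).ge
  -- For k ≥ N, monotonicity squeezes the row between two entries of the stable diagonal.
  · calc _ ≤ (OrderDual.ofDual (f N)).leadingSocle x N :=
          Submodule.leadingSocle_mono (hf (Nat.le_add_right _ _)) hk
      _ = (OrderDual.ofDual (f (m + k))).leadingSocle x (m + k) := hN (m + k) (by lia)
      _ ≤ _ := Submodule.leadingSocle_mono (hf (Nat.le_add_right _ _)) (Nat.le_add_left _ _)

lemma isArtinian_of_torsionBySet_finset (s : Finset S) {T : Type v} [AddCommGroup T] [Module S T]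
    (hs : ∀ x ∈ s, ∀ t : T, ∃ n : ℕ, x ^ n • t = 0)
    (h : IsArtinian S (Submodule.torsionBySet S T (s : Set S))) : IsArtinian S T := by
  classical
  induction s using Finset.induction_on generalizing T with
  | empty =>
    refine isArtinian_of_injective (LinearMap.codRestrict
      (Submodule.torsionBySet S T ((∅ : Finset S) : Set S)) LinearMap.id fun t ↦ ?_)
      fun x y e ↦ congrArg Subtype.val e
    simp [Submodule.mem_torsionBySet_iff]
  | insert x s _ ih =>
    have : IsArtinian S (Submodule.torsionBy S T x) := by
      refine ih (fun y hy t ↦ ?_) ?_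
      · obtain ⟨n, hn⟩ := hs y (Finset.mem_insert_of_mem hy) t.1
        exact ⟨n, Subtype.ext hn⟩
      · refine isArtinian_of_injective (P := Submodule.torsionBySet S T (insert x s : Finset S))
          (LinearMap.codRestrict _ ((Submodule.torsionBy S T x).subtype ∘ₗ Submodule.subtype _)
            fun t ↦ ?_) fun t t' e ↦ by
              have e' : t.1.1 = t'.1.1 :=
                congrArg (Submodule.subtype (Submodule.torsionBySet S T (insert x s : Finset S))) e
              exact Subtype.ext (Subtype.ext e')
        rw [Submodule.mem_torsionBySet_iff]
        rintro ⟨y, hy⟩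
        rcases Finset.mem_insert.1 hy with rfl | hy
        · exact t.1.2
        · exact congrArg Subtype.val ((Submodule.mem_torsionBySet_iff _ _).1 t.2 ⟨y, hy⟩)
    exact isArtinian_of_torsionBy (hs x (Finset.mem_insert_self x s))

lemma Ideal.IsPowTorsion.isArtinian {a : Ideal S} (ha : a.FG) (hT : a.IsPowTorsion T)
    (h : IsArtinian S (Submodule.torsionBySet S T (a : Set S))) : IsArtinian S T := by
  obtain ⟨s, rfl⟩ := ha
  refine isArtinian_of_torsionBySet_finset s (fun x hx t ↦ ?_) ?_
  · obtain ⟨n, hn⟩ := hT t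
    exact ⟨n, hn _ (Ideal.pow_mem_pow (Ideal.subset_span hx) n)⟩
  · rwa [Submodule.torsionBySet_eq_torsionBySet_span]

end ArtinianOfTorsion

/-! ### A substitute for secondary representations. -/

section Secondary

variable {S : Type u} [CommRing S] {T : Type v} [AddCommGroup T] [Module S T]

/-- A Fitting decomposition: once the `x ^ n • A` stabilize, A is the sum of its `x ^ (n +
1)`-torsion and `x ^ (n + 1) • A`. -/
lemma exists_sup_of_not_secondary [IsArtinian S T] (A : Submodule S T) {x : S}
    (h₁ : A.map (LinearMap.lsmul S T x) ≠ A)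
    (h₂ : ∀ n : ℕ, A.map (LinearMap.lsmul S T (x ^ n)) ≠ ⊥) :
    ∃ B C : Submodule S T, B < A ∧ C < A ∧ A ≤ B ⊔ C := by
  have hle : ∀ y : S, A.map (LinearMap.lsmul S T y) ≤ A := by
    rintro y _ ⟨t, ht, rfl⟩
    exact A.smul_mem y ht
  obtain ⟨n, hn⟩ := (monotone_stabilizes_iff_artinian (R := S) (M := T)).2 inferInstance
    ⟨fun n ↦ OrderDual.toDual (A.map (LinearMap.lsmul S T (x ^ n))), fun i j h ↦ by
      rintro _ ⟨t, ht, rfl⟩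
      refine ⟨x ^ (j - i) • t, A.smul_mem _ ht, ?_⟩
      simp only [LinearMap.lsmul_apply]
      rw [smul_smul, ← pow_add, Nat.add_sub_cancel' h]⟩
  -- The exponent n + 1 is positive even if n = 0, so that `x ^ (n + 1) • A = A` forces `x • A = A`.
  have hn' : A.map (LinearMap.lsmul S T (x ^ (n + 1))) =
      A.map (LinearMap.lsmul S T (x ^ (n + 1 + (n + 1)))) :=
    (hn (n + 1) (by lia)).symm.trans (hn (n + 1 + (n + 1)) (by lia))
  refine ⟨A ⊓ Submodule.torsionBy S T (x ^ (n + 1)), A.map (LinearMap.lsmul S T (x ^ (n + 1))),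
    lt_of_le_of_ne inf_le_left fun e ↦ h₂ (n + 1) ?_, lt_of_le_of_ne (hle _) fun e ↦ h₁ ?_, ?_⟩
  · rw [eq_bot_iff]
    rintro _ ⟨t, ht, rfl⟩
    rw [← e] at ht
    exact ht.2
  · refine le_antisymm (hle x) ?_
    conv_lhs => rw [← e]
    rintro _ ⟨t, ht, rfl⟩
    refine ⟨x ^ n • t, A.smul_mem _ ht, ?_⟩
    simp only [LinearMap.lsmul_apply]
    rw [smul_smul, ← pow_succ']
  · intro t ht
    obtain ⟨w, hw, e⟩ : x ^ (n + 1) • t ∈ A.map (LinearMap.lsmul S T (x ^ (n + 1 + (n + 1)))) :=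
      hn' ▸ ⟨t, ht, rfl⟩
    refine Submodule.mem_sup.2 ⟨t - x ^ (n + 1) • w, ⟨A.sub_mem ht (A.smul_mem _ hw), ?_⟩,
      x ^ (n + 1) • w, ⟨w, hw, rfl⟩, sub_add_cancel _ _⟩
    rw [SetLike.mem_coe, Submodule.mem_torsionBy_iff, smul_sub, smul_smul, ← pow_add, sub_eq_zero]
    exact e.symm

lemma Ideal.isPrime_radical_annihilator_of_secondary (A : Submodule S T) (hA : A ≠ ⊥)
    (h : ∀ x : S, A.map (LinearMap.lsmul S T x) = A ∨
      ∃ n : ℕ, A.map (LinearMap.lsmul S T (x ^ n)) = ⊥) : A.annihilator.radical.IsPrime := by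
  have hmem : ∀ y : S, y ∈ A.annihilator ↔ A.map (LinearMap.lsmul S T y) = ⊥ := by
    intro y
    rw [Submodule.mem_annihilator, eq_bot_iff, Submodule.map_le_iff_le_comap]
    rfl
  refine ⟨fun e ↦ hA ?_, fun {x y} hxy ↦ ?_⟩
  · rwa [Ideal.radical_eq_top, Submodule.annihilator_eq_top_iff] at e
  · rcases h x with hx | ⟨n, hn⟩
    · obtain ⟨n, hn⟩ := hxy
      right
      have hxn : ∀ t ∈ A, ∃ w ∈ A, x ^ n • w = t := by
        clear hn
        induction n with
        | zero => exact fun t ht ↦ ⟨t, ht, by simp⟩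
        | succ n ih =>
          intro t ht
          obtain ⟨w, hw, rfl⟩ := ih t ht
          obtain ⟨w', hw', rfl⟩ : w ∈ A.map (LinearMap.lsmul S T x) := hx.symm ▸ hw
          exact ⟨w', hw', by rw [LinearMap.lsmul_apply, smul_smul, ← pow_succ]⟩
      refine ⟨n, Submodule.mem_annihilator.2 fun t ht ↦ ?_⟩
      obtain ⟨w, hw, rfl⟩ := hxn t ht
      rw [smul_smul, ← mul_pow, mul_comm y x]
      exact Submodule.mem_annihilator.1 hn w hw
    · exact Or.inl ⟨n, (hmem _).2 hn⟩

/-- By induction A may be taken secondary, with q the radical of its annihilator. If I ⊆ q, a power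
of I kills A, and A lies in a finitely generated torsion submodule. Otherwise any x outside q
satisfies xA = A, so A ⊆ xT. -/
lemma exists_finset_primes_of_isArtinian [IsArtinian S T] {I : Ideal S} (hI : I.FG)
    (hfg : ∀ k : ℕ, (Submodule.torsionBySet S T ((I ^ k : Ideal S) : Set S)).FG)
    (A : Submodule S T) :
    ∃ Q : Finset (Ideal S), (∀ q ∈ Q, q.IsPrime ∧ ¬ I ≤ q) ∧ ∀ x : S, (∀ q ∈ Q, x ∉ q) →
      ∃ F : Submodule S T, F.FG ∧ A ≤ F ⊔ (⊤ : Submodule S T).map (LinearMap.lsmul S T x) := by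
  classical
  induction A using WellFoundedLT.induction with
  | ind A ih =>
  by_cases h : ∀ x : S, A.map (LinearMap.lsmul S T x) = A ∨
      ∃ n : ℕ, A.map (LinearMap.lsmul S T (x ^ n)) = ⊥
  · by_cases hA : A = ⊥
    · exact ⟨∅, by simp, fun x _ ↦ ⟨⊥, Submodule.fg_bot, hA.le.trans bot_le⟩⟩
    by_cases hIA : I ≤ A.annihilator.radical
    · obtain ⟨k, hk⟩ := Ideal.exists_pow_le_of_le_radical_of_fg hIA hI
      refine ⟨∅, by simp, fun x _ ↦ ⟨_, hfg k, le_sup_of_le_left fun t ht ↦ ?_⟩⟩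
      rw [Submodule.mem_torsionBySet_iff]
      exact fun y ↦ Submodule.mem_annihilator.1 (hk y.2) t ht
    · refine ⟨{A.annihilator.radical}, fun q hq ↦ ?_, fun x hx ↦ ⟨⊥, Submodule.fg_bot, ?_⟩⟩
      · rw [Finset.mem_singleton.1 hq]
        exact ⟨Ideal.isPrime_radical_annihilator_of_secondary A hA h, hIA⟩
      · refine le_sup_of_le_right ?_
        rcases h x with hx' | ⟨n, hn⟩
        · conv_lhs => rw [← hx']
          exact Submodule.map_mono le_top
        · refine absurd ⟨n, ?_⟩ (hx _ (Finset.mem_singleton_self _))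
          rw [Submodule.mem_annihilator]
          exact fun t ht ↦ (Submodule.mem_bot S).1 (hn ▸ ⟨t, ht, rfl⟩)
  · push Not at h
    obtain ⟨x, h₁, h₂⟩ := h
    obtain ⟨B, C, hB, hC, hBC⟩ := exists_sup_of_not_secondary A h₁ h₂
    obtain ⟨Q, hQ, hQ'⟩ := ih B hB
    obtain ⟨P, hP, hP'⟩ := ih C hC
    refine ⟨Q ∪ P, fun q hq ↦ (Finset.mem_union.1 hq).elim (hQ q) (hP q), fun x hx ↦ ?_⟩
    obtain ⟨F, hF, hBF⟩ := hQ' x fun q hq ↦ hx q (Finset.mem_union_left _ hq)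
    obtain ⟨G, hG, hCG⟩ := hP' x fun q hq ↦ hx q (Finset.mem_union_right _ hq)
    refine ⟨F ⊔ G, hF.sup hG, hBC.trans (sup_le (hBF.trans ?_) (hCG.trans ?_))⟩
    · exact sup_le_sup_right le_sup_left _
    · exact sup_le_sup_right le_sup_right _

end Secondary

/-! ### Finiteness of the torsion of powers; finite length. -/

section FiniteTorsion

variable {R : Type u} [CommRing R] [IsNoetherianRing R] (a : Ideal R)
  {T : Type v} [AddCommGroup T] [Module R T]

/-- Multiplication by generators of `a` maps the `a^(k+1)`-torsion to a finite power of the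
`a^k`-torsion, with kernel the `a`-torsion. -/
lemma Submodule.torsionBySet_pow_fg
    (h : (Submodule.torsionBySet R T (a : Set R)).FG) (k : ℕ) :
    (Submodule.torsionBySet R T ((a ^ k : Ideal R) : Set R)).FG := by
  induction k with
  | zero =>
    rw [pow_zero, Ideal.one_eq_top, Submodule.top_coe, Submodule.torsionBySet_univ]
    exact Submodule.fg_bot
  | succ k ih =>
    obtain ⟨s, hs⟩ := IsNoetherian.noetherian a
    have : Module.Finite R (torsionBySet R T (a : Set R)) := Module.Finite.iff_fg.2 h
    have : Module.Finite R (torsionBySet R T ((a ^ k : Ideal R) : Set R)) :=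
      Module.Finite.iff_fg.2 ih
    have hle : torsionBySet R T (a : Set R) ≤ torsionBySet R T ((a ^ (k + 1) : Ideal R) : Set R) :=
      torsionBySet_le_torsionBySet_of_subset (Ideal.pow_le_self k.succ_ne_zero)
    let g : torsionBySet R T ((a ^ (k + 1) : Ideal R) : Set R) →ₗ[R]
        (s → torsionBySet R T ((a ^ k : Ideal R) : Set R)) :=
      LinearMap.pi fun x ↦ LinearMap.codRestrict _
        (LinearMap.lsmul R T x.1 ∘ₗ Submodule.subtype _) fun t ↦ by
          rw [mem_torsionBySet_iff]
          intro y
          have := (mem_torsionBySet_iff _ _).1 t.2 ⟨y.1 * x.1, by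
            rw [pow_succ]
            exact Ideal.mul_mem_mul y.2 (hs ▸ Ideal.subset_span x.2)⟩
          simpa [mul_smul] using this
    have := isNoetherian_of_range_eq_ker (Submodule.inclusion hle) g (by
      rw [Submodule.range_inclusion]
      ext t
      have has : torsionBySet R T (a : Set R) = torsionBySet R T (s : Set R) := by
        rw [Submodule.torsionBySet_eq_torsionBySet_span (s : Set R), ← hs]
      rw [Submodule.mem_comap, has, mem_torsionBySet_iff, LinearMap.mem_ker, funext_iff]
      exact forall_congr' fun x ↦ (Subtype.ext_iff (a1 := g t x) (a2 := 0)).symm)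
    exact Module.Finite.iff_fg.1 inferInstance

lemma isArtinian_of_support_subset_maximal [Module.Finite R T]
    (h : ∀ p ∈ Module.support R T, p.asIdeal.IsMaximal) : IsArtinian R T := by
  induction ‹Module.Finite R T› using
    IsNoetherianRing.induction_on_isQuotientEquivQuotientPrime R with
  | subsingleton N => infer_instance
  | quotient N p e =>
    have hp : p ∈ Module.support R N := by
      rw [e.support_eq, Module.support_of_algebra, Ideal.Quotient.algebraMap_eq, Ideal.mk_ker]
      exact le_refl p.asIdeal
    have := h p hp
    have : IsSimpleModule R (R ⧸ p.asIdeal) := isSimpleModule_iff_isCoatom.2 this.out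
    exact isArtinian_of_injective e.toLinearMap e.injective
  | exact N₁ N₂ N₃ f g hf hg hfg h₁ h₃ =>
    have := h₁ fun p hp ↦ h p (Module.support_subset_of_injective f hf hp)
    have := h₃ fun p hp ↦ h p (Module.support_subset_of_surjective g hg hp)
    exact isArtinian_of_range_eq_ker f g hfg.linearMap_ker_eq.symm

end FiniteTorsion

/-! ### Torsion and supports under localization at a prime. -/

section LocalizedTorsion

variable {R : Type u} [CommRing R] (p : Ideal R) [p.IsPrime]
  {T : Type v} [AddCommGroup T] [Module R T]

variable (b : Ideal R)

lemma LocalizedModule.algebraMap_smul_mk (r : R) (t : T) (s : p.primeCompl) :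
    algebraMap R (Localization.AtPrime p) r •
      (LocalizedModule.mk t s : LocalizedModule p.primeCompl T) = LocalizedModule.mk (r • t) s := by
  rw [algebraMap_smul, LocalizedModule.smul'_mk]

lemma LocalizedModule.smul_mk_eq_zero_of_mem_map {t : T} (h : ∀ x ∈ b, x • t = 0)
    (s : p.primeCompl) {y : Localization.AtPrime p}
    (hy : y ∈ b.map (algebraMap R (Localization.AtPrime p))) :
    y • (LocalizedModule.mk t s : LocalizedModule p.primeCompl T) = 0 := by
  have : b.map (algebraMap R (Localization.AtPrime p)) ≤ (Submodule.span (Localization.AtPrime p)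
      {(LocalizedModule.mk t s : LocalizedModule p.primeCompl T)}).annihilator := by
    rw [Ideal.map_le_iff_le_comap]
    intro x hx
    rw [Ideal.mem_comap, Submodule.mem_annihilator_span_singleton,
      LocalizedModule.algebraMap_smul_mk, h x hx, LocalizedModule.zero_mk]
  exact (Submodule.mem_annihilator_span_singleton _ _).1 (this hy)

lemma Ideal.IsPowTorsion.localizedModule {a : Ideal R} (h : a.IsPowTorsion T) :
    (a.map (algebraMap R (Localization.AtPrime p))).IsPowTorsion
      (LocalizedModule p.primeCompl T) := by
  intro z
  induction z with
  | h t s =>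
    obtain ⟨n, hn⟩ := h t
    refine ⟨n, fun y hy ↦ ?_⟩
    rw [← Ideal.map_pow] at hy
    exact LocalizedModule.smul_mk_eq_zero_of_mem_map p (a ^ n) hn s hy

lemma exists_mul_smul_eq_zero_of_fg {t : T} (hb : b.FG)
    (h : ∀ x ∈ b, ∃ u ∈ p.primeCompl, u • x • t = 0) :
    ∃ u ∈ p.primeCompl, ∀ x ∈ b, x • u • t = 0 := by
  induction b, hb using Submodule.fg_induction with
  | singleton x =>
    obtain ⟨u, hu, e⟩ := h x (Submodule.mem_span_singleton_self x)
    refine ⟨u, hu, fun y hy ↦ ?_⟩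
    obtain ⟨r, rfl⟩ := Submodule.mem_span_singleton.1 hy
    rw [smul_assoc, smul_comm x u, e, smul_zero]
  | sup b₁ b₂ _ _ h₁ h₂ =>
    obtain ⟨u₁, hu₁, e₁⟩ := h₁ fun x hx ↦ h x (Submodule.mem_sup_left hx)
    obtain ⟨u₂, hu₂, e₂⟩ := h₂ fun x hx ↦ h x (Submodule.mem_sup_right hx)
    refine ⟨u₁ * u₂, mul_mem hu₁ hu₂, fun y hy ↦ ?_⟩
    obtain ⟨y₁, hy₁, y₂, hy₂, rfl⟩ := Submodule.mem_sup.1 hy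
    rw [add_smul, mul_smul, smul_comm y₂, e₂ y₂ hy₂, smul_zero, smul_comm u₁ u₂ t, smul_comm y₁,
      e₁ y₁ hy₁, smul_zero, add_zero]

lemma Submodule.torsionBySet_localizedModule_fg (hb : b.FG)
    (h : (Submodule.torsionBySet R T (b : Set R)).FG) :
    (Submodule.torsionBySet (Localization.AtPrime p) (LocalizedModule p.primeCompl T)
      (b.map (algebraMap R (Localization.AtPrime p)) : Set (Localization.AtPrime p))).FG := by
  obtain ⟨s, hs⟩ := h
  classical
  refine ⟨s.image (LocalizedModule.mkLinearMap p.primeCompl T), ?_⟩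
  rw [Finset.coe_image]
  apply le_antisymm
  · rw [Submodule.span_le]
    rintro _ ⟨t, ht, rfl⟩
    rw [SetLike.mem_coe, mem_torsionBySet_iff]
    have ht' : t ∈ torsionBySet R T (b : Set R) := hs ▸ Submodule.subset_span ht
    exact fun y ↦ LocalizedModule.smul_mk_eq_zero_of_mem_map p b
      (fun x hx ↦ (mem_torsionBySet_iff _ _).1 ht' ⟨x, hx⟩) 1 y.2
  · intro z hz
    rw [mem_torsionBySet_iff] at hz
    induction z with
    | h t v =>
      obtain ⟨u, hu, e⟩ := exists_mul_smul_eq_zero_of_fg p b (t := t) hb fun x hx ↦ by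
        have := hz ⟨_, Ideal.mem_map_of_mem _ hx⟩
        rw [LocalizedModule.algebraMap_smul_mk, ← LocalizedModule.zero_mk v,
          LocalizedModule.mk_eq] at this
        obtain ⟨u, hu⟩ := this
        refine ⟨u * v, mul_mem u.2 v.2, ?_⟩
        simpa [mul_smul, Submonoid.smul_def] using hu
      have hut : u • t ∈ Submodule.span R (s : Set T) := by
        rw [hs, mem_torsionBySet_iff]
        exact fun x ↦ e x x.2
      have h1 : (LocalizedModule.mkLinearMap p.primeCompl T) (u • t) ∈
          Submodule.span (Localization.AtPrime p)
            (LocalizedModule.mkLinearMap p.primeCompl T '' s) := by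
        refine Submodule.span_le_restrictScalars R (Localization.AtPrime p) _ ?_
        rw [Submodule.span_image]
        exact ⟨_, hut, rfl⟩
      have h2 : (LocalizedModule.mk t v : LocalizedModule p.primeCompl T) =
          (Localization.mk 1 (⟨u, hu⟩ * v) : Localization.AtPrime p) •
            LocalizedModule.mkLinearMap p.primeCompl T (u • t) := by
        rw [LocalizedModule.mkLinearMap_apply, LocalizedModule.mk_smul_mk, one_smul, mul_one,
          LocalizedModule.mk_eq]
        refine ⟨1, ?_⟩
        simp only [Submonoid.smul_def, one_smul, mul_smul]
        rw [smul_comm]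
      rw [h2]
      exact Submodule.smul_mem _ _ h1

/-- L is spanned by numerators of generators of F; L + xT then localizes to the whole module. -/
lemma notMem_support_quotient_of_top_le
    {F : Submodule (Localization.AtPrime p) (LocalizedModule p.primeCompl T)} (hF : F.FG) (x : R)
    (h : ⊤ ≤ F ⊔ (⊤ : Submodule (Localization.AtPrime p) (LocalizedModule p.primeCompl T)).map
      (LinearMap.lsmul (Localization.AtPrime p) (LocalizedModule p.primeCompl T)
        (algebraMap R (Localization.AtPrime p) x))) :
    ∃ L : Submodule R T, L.FG ∧ (⟨p, inferInstance⟩ : PrimeSpectrum R) ∉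
      Module.support R (T ⧸ L ⊔ (⊤ : Submodule R T).map (LinearMap.lsmul R T x)) := by
  classical
  obtain ⟨s, rfl⟩ := hF
  have hrep : ∀ z : LocalizedModule p.primeCompl T, ∃ t : T, ∃ v : p.primeCompl,
      LocalizedModule.mk t v = z := by
    intro z
    induction z with
    | h t v => exact ⟨t, v, rfl⟩
  choose t v htv using hrep
  let L := Submodule.span R (s.image t : Set T)
  refine ⟨L, ⟨s.image t, rfl⟩, Module.notMem_support_iff'.2 fun m ↦ ?_⟩
  obtain ⟨m, rfl⟩ := Submodule.mkQ_surjective _ m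
  set W := L ⊔ (⊤ : Submodule R T).map (LinearMap.lsmul R T x) with hW
  have hle : Submodule.span (Localization.AtPrime p) (s : Set (LocalizedModule p.primeCompl T)) ⊔
      (⊤ : Submodule (Localization.AtPrime p) (LocalizedModule p.primeCompl T)).map
        (LinearMap.lsmul (Localization.AtPrime p) (LocalizedModule p.primeCompl T)
          (algebraMap R (Localization.AtPrime p) x)) ≤
      W.localized p.primeCompl := by
    refine sup_le (Submodule.span_le.2 fun z hz ↦ ?_) ?_
    · rw [SetLike.mem_coe, Submodule.mem_localized']
      refine ⟨t z, Submodule.mem_sup_left (Submodule.subset_span ?_), v z, ?_⟩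
      · exact Finset.mem_image_of_mem t hz
      · rw [← IsLocalizedModule.mk_eq_mk', htv]
    · rintro _ ⟨z, -, rfl⟩
      rw [Submodule.mem_localized']
      refine ⟨x • t z, Submodule.mem_sup_right ⟨t z, trivial, rfl⟩, v z, ?_⟩
      rw [← IsLocalizedModule.mk_eq_mk', LinearMap.lsmul_apply,
        ← LocalizedModule.algebraMap_smul_mk, htv]
  obtain ⟨w, hw, u, e⟩ := (Submodule.mem_localized' ..).1
    (hle (h (Submodule.mem_top (x := LocalizedModule.mk m 1))))
  rw [← IsLocalizedModule.mk_eq_mk', LocalizedModule.mk_eq] at e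
  obtain ⟨r, hr⟩ := e
  refine ⟨r * u, mul_mem r.2 u.2, ?_⟩
  rw [← map_smul]
  refine (Submodule.Quotient.mk_eq_zero _).2 ?_
  have : (r * u : R) • m = (r : R) • w := by
    simpa [Submonoid.smul_def, mul_smul] using hr.symm
  rw [this]
  exact W.smul_mem _ hw

lemma comap_mem_support_of_mem_support_localizedModule {q : PrimeSpectrum (Localization.AtPrime p)}
    (hq : q ∈ Module.support (Localization.AtPrime p) (LocalizedModule p.primeCompl T)) :
    PrimeSpectrum.comap (algebraMap R (Localization.AtPrime p)) q ∈ Module.support R T := by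
  rw [Module.mem_support_iff_exists_annihilator] at hq ⊢
  obtain ⟨z, hz⟩ := hq
  induction z with
  | h t v =>
    refine ⟨t, fun y hy ↦ hz ?_⟩
    rw [Submodule.mem_annihilator_span_singleton] at hy ⊢
    rw [LocalizedModule.algebraMap_smul_mk, hy, LocalizedModule.zero_mk]

end LocalizedTorsion

/-! ### Choosing a generic element of `a`. -/

section GenericElement

lemma exists_mem_forall_notMem_of_finset {R : Type u} [CommRing R] {a : Ideal R}
    (Q : Finset (Ideal R))
    (hQ : ∀ q ∈ Q, q.IsPrime ∧ ¬ a ≤ q) : ∃ x ∈ a, ∀ q ∈ Q, x ∉ q := by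
  by_contra! h
  obtain ⟨q, hq, haq⟩ := (Ideal.subset_union_prime (f := fun q : Ideal R ↦ q) (s := Q) (I := a)
    ⊥ ⊥ (fun q hq _ _ ↦ (hQ q hq).1)).1 fun x hx ↦ by
      obtain ⟨q, hq, hxq⟩ := h x hx
      exact Set.mem_biUnion hq hxq
  exact (hQ q hq).2 haq

variable {R : Type u} [CommRing R] [IsNoetherianRing R] {a : Ideal R}
  {T : Type v} [AddCommGroup T] [Module R T]

/-- By minimality of p, the `a`-torsion of T_p is finitely generated and supported at most at the
closed point, hence Artinian; so T_p is Artinian by Melkersson's criterion. The primes found over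
R_p are contracted to R. -/
lemma exists_finset_primes_of_minimal_mem_support (hT : a.IsPowTorsion T)
    (hfg : (Submodule.torsionBySet R T (a : Set R)).FG) (p : PrimeSpectrum R)
    (hp : ∀ q ∈ Module.support R T, q ≤ p → q = p) :
    ∃ Q : Finset (Ideal R), (∀ q ∈ Q, q.IsPrime ∧ ¬ a ≤ q) ∧ ∀ x : R, (∀ q ∈ Q, x ∉ q) →
      ∃ L : Submodule R T, L.FG ∧
        p ∉ Module.support R (T ⧸ L ⊔ (⊤ : Submodule R T).map (LinearMap.lsmul R T x)) := by
  classical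
  let S := Localization.AtPrime p.asIdeal
  let T' := LocalizedModule p.asIdeal.primeCompl T
  let I := a.map (algebraMap R S)
  have : IsNoetherianRing S := IsLocalization.isNoetherianRing p.asIdeal.primeCompl S inferInstance
  have hfgk : ∀ k : ℕ, (Submodule.torsionBySet S T' ((I ^ k : Ideal S) : Set S)).FG := by
    intro k
    rw [← Ideal.map_pow]
    exact Submodule.torsionBySet_localizedModule_fg _ _ (IsNoetherian.noetherian _)
      (Submodule.torsionBySet_pow_fg a hfg k)
  have hfin : Module.Finite S (Submodule.torsionBySet S T' (I : Set S)) :=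
    Module.Finite.iff_fg.2 (by simpa using hfgk 1)
  have hart : IsArtinian S (Submodule.torsionBySet S T' (I : Set S)) := by
    refine isArtinian_of_support_subset_maximal fun q hq ↦ ?_
    have h1 := comap_mem_support_of_mem_support_localizedModule p.asIdeal
      (Module.support_subset_of_injective (Submodule.subtype _) Subtype.val_injective hq)
    have h2 : PrimeSpectrum.comap (algebraMap R S) q ≤ p := by
      intro y hy
      by_contra hyp
      exact q.2.ne_top (Ideal.eq_top_of_isUnit_mem _ hy
        (IsLocalization.map_units S (⟨y, hyp⟩ : p.asIdeal.primeCompl)))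
    have h3 := congrArg PrimeSpectrum.asIdeal (hp _ h1 h2)
    have h4 : q.asIdeal = IsLocalRing.maximalIdeal S := by
      refine Eq.trans ?_ Localization.AtPrime.map_eq_maximalIdeal
      refine Eq.trans ?_ (congrArg (Ideal.map (algebraMap R S)) h3)
      exact (IsLocalization.map_under p.asIdeal.primeCompl S q.asIdeal).symm
    rw [h4]
    infer_instance
  have : IsArtinian S T' :=
    (hT.localizedModule p.asIdeal).isArtinian (IsNoetherian.noetherian I) hart
  obtain ⟨Q, hQ, hQ'⟩ := exists_finset_primes_of_isArtinian (IsNoetherian.noetherian I) hfgk ⊤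
  refine ⟨Q.image (Ideal.comap (algebraMap R S)), fun q hq ↦ ?_, fun x hx ↦ ?_⟩
  · obtain ⟨q, hq', rfl⟩ := Finset.mem_image.1 hq
    have := (hQ q hq').1
    exact ⟨inferInstance, fun h ↦ (hQ q hq').2 (Ideal.map_le_iff_le_comap.2 h)⟩
  · obtain ⟨F, hF, h⟩ := hQ' (algebraMap R S x) fun q hq ↦ hx _ (Finset.mem_image_of_mem _ hq)
    exact notMem_support_quotient_of_top_le p.asIdeal hF x h

theorem exists_mem_and_fg_forall_notMem_support (hT : a.IsPowTorsion T)
    (hfg : (Submodule.torsionBySet R T (a : Set R)).FG) {P : Set (PrimeSpectrum R)}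
    (hPf : P.Finite) (hP : ∀ p ∈ P, ∀ q ∈ Module.support R T, q ≤ p → q = p) :
    ∃ x ∈ a, ∃ L : Submodule R T, L.FG ∧ ∀ p ∈ P,
      p ∉ Module.support R (T ⧸ L ⊔ (⊤ : Submodule R T).map (LinearMap.lsmul R T x)) := by
  classical
  have : Finite P := hPf
  have : Fintype P := Fintype.ofFinite P
  choose Q hQ hQ' using fun p : P ↦
    exists_finset_primes_of_minimal_mem_support hT hfg p.1 (hP p.1 p.2)
  obtain ⟨x, hxa, hx⟩ := exists_mem_forall_notMem_of_finset (a := a) (Finset.univ.biUnion Q)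
    fun q hq ↦ by
      obtain ⟨p, -, hq⟩ := Finset.mem_biUnion.1 hq
      exact hQ p q hq
  choose L hL hL' using fun p : P ↦ hQ' p x fun q hq ↦
    hx q (Finset.mem_biUnion.2 ⟨p, Finset.mem_univ p, hq⟩)
  refine ⟨x, hxa, ⨆ p, L p, Submodule.fg_iSup _ hL, fun p hp hsupp ↦ hL' ⟨p, hp⟩ ?_⟩
  have hle : L ⟨p, hp⟩ ⊔ (⊤ : Submodule R T).map (LinearMap.lsmul R T x) ≤
      (⨆ p, L p) ⊔ (⊤ : Submodule R T).map (LinearMap.lsmul R T x) :=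
    sup_le_sup_right (le_iSup L ⟨p, hp⟩) _
  exact Module.support_subset_of_surjective (Submodule.factor hle)
    (Submodule.factor_surjective hle) hsupp

end GenericElement

/-! ### Finiteness of Ext(R/a, -). -/

section

open CategoryTheory Abelian

section ExtFinite

variable {R : Type u} [CommRing R] (a : Ideal R)

/-- The module `Ext^j(R/a, T)` is finitely generated. -/
def Ideal.ExtFinite (T : Type u) [AddCommGroup T] [Module R T] (j : ℕ) : Prop :=
  Module.Finite R (Ext (ModuleCat.of R (R ⧸ a)) (ModuleCat.of R T) j)

lemma Module.Finite.of_function_exact [IsNoetherianRing R] {X Y Z : Type*} [AddCommGroup X]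
    [Module R X] [AddCommGroup Y] [Module R Y] [AddCommGroup Z] [Module R Z] (f : X →ₗ[R] Y)
    (g : Y →ₗ[R] Z) (h : Function.Exact f g) (_ : Module.Finite R X) (_ : Module.Finite R Z) :
    Module.Finite R Y := by
  have := isNoetherian_of_range_eq_ker f g h.linearMap_ker_eq.symm
  infer_instance

section ShortExact

variable {a} {A B C : Type u} [AddCommGroup A] [Module R A] [AddCommGroup B]
  [Module R B] [AddCommGroup C] [Module R C] {f : A →ₗ[R] B} {g : B →ₗ[R] C}

lemma ModuleCat.shortExact_of_exact (hf : Function.Injective f) (hg : Function.Surjective g)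
    (h : Function.Exact f g) :
    (ModuleCat.shortComplexOfCompEqZero f g h.linearMap_comp_eq_zero).ShortExact :=
  ModuleCat.shortComplex_shortExact _ h hf hg

variable [IsNoetherianRing R]

lemma Ideal.ExtFinite.middle (hf : Function.Injective f) (hg : Function.Surjective g)
    (h : Function.Exact f g) {j : ℕ} (hA : a.ExtFinite A j) (hC : a.ExtFinite C j) :
    a.ExtFinite B j := by
  have hS := ModuleCat.shortExact_of_exact hf hg h
  exact .of_function_exact
    ((Ext.mk₀ (ModuleCat.ofHom f)).postcompOfLinear R (ModuleCat.of R (R ⧸ a)) (add_zero j))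
    ((Ext.mk₀ (ModuleCat.ofHom g)).postcompOfLinear R (ModuleCat.of R (R ⧸ a)) (add_zero j))
    ((ShortComplex.ab_exact_iff_function_exact _).1
      (Ext.covariant_sequence_exact₂' (ModuleCat.of R (R ⧸ a)) hS j)) hA hC

lemma Ideal.ExtFinite.right (hf : Function.Injective f) (hg : Function.Surjective g)
    (h : Function.Exact f g) {j : ℕ} (hB : a.ExtFinite B j) (hA : a.ExtFinite A (j + 1)) :
    a.ExtFinite C j := by
  have hS := ModuleCat.shortExact_of_exact hf hg h
  exact .of_function_exact
    ((Ext.mk₀ (ModuleCat.ofHom g)).postcompOfLinear R (ModuleCat.of R (R ⧸ a)) (add_zero j))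
    (hS.extClass.postcompOfLinear R (ModuleCat.of R (R ⧸ a)) rfl)
    ((ShortComplex.ab_exact_iff_function_exact _).1
      (Ext.covariant_sequence_exact₃' (ModuleCat.of R (R ⧸ a)) hS j (j + 1) rfl)) hB hA

lemma Ideal.ExtFinite.left (hf : Function.Injective f) (hg : Function.Surjective g)
    (h : Function.Exact f g) {j : ℕ} (hC : a.ExtFinite C j) (hB : a.ExtFinite B (j + 1)) :
    a.ExtFinite A (j + 1) := by
  have hS := ModuleCat.shortExact_of_exact hf hg h
  exact .of_function_exact
    (hS.extClass.postcompOfLinear R (ModuleCat.of R (R ⧸ a)) rfl)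
    ((Ext.mk₀ (ModuleCat.ofHom f)).postcompOfLinear R (ModuleCat.of R (R ⧸ a))
      (add_zero (j + 1)))
    ((ShortComplex.ab_exact_iff_function_exact _).1
      (Ext.covariant_sequence_exact₁' (ModuleCat.of R (R ⧸ a)) hS j (j + 1) rfl)) hC hB

lemma Ideal.ExtFinite.of_injective (hf : Function.Injective f) (hB : a.ExtFinite B 0) :
    a.ExtFinite A 0 := by
  have : Mono (ModuleCat.ofHom f) := (ModuleCat.mono_iff_injective _).2 hf
  have : Module.Finite R _ := hB
  exact Module.Finite.of_injective
    ((Ext.mk₀ (ModuleCat.ofHom f)).postcompOfLinear R (ModuleCat.of R (R ⧸ a)) (add_zero 0))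
    (Ext.postcomp_mk₀_injective_of_mono (ModuleCat.of R (R ⧸ a)) (ModuleCat.ofHom f))

lemma Ideal.ExtFinite.of_finite [Module.Finite R A] (j : ℕ) : a.ExtFinite A j :=
  ModuleCat.finite_ext R (ModuleCat.of R (R ⧸ a)) (ModuleCat.of R A) j

lemma Ideal.ExtFinite.of_equiv (e : A ≃ₗ[R] B) {j : ℕ} (hA : a.ExtFinite A j) :
    a.ExtFinite B j :=
  .middle (C := PUnit.{u + 1}) (f := e.toLinearMap) (g := 0) e.injective
    (fun _ ↦ ⟨0, Subsingleton.elim _ _⟩)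
    ((e.toLinearMap.exact_zero_iff_surjective _).2 e.surjective) hA (.of_finite j)

lemma Ideal.ExtFinite.of_subsingleton [Subsingleton A] (j : ℕ) : a.ExtFinite A j := .of_finite j

lemma Ideal.ExtFinite.quotient_of_fg {j : ℕ} (hA : a.ExtFinite A j) {L : Submodule R A}
    (hL : L.FG) : a.ExtFinite (A ⧸ L) j := by
  have : Module.Finite R L := Module.Finite.iff_fg.2 hL
  exact .right L.injective_subtype L.mkQ_surjective (LinearMap.exact_subtype_mkQ L) hA
    (.of_finite _)

lemma Ideal.ExtFinite.of_quotient_of_fg {j : ℕ} {L : Submodule R A} (hL : L.FG)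
    (hA : a.ExtFinite (A ⧸ L) j) : a.ExtFinite A j := by
  have : Module.Finite R L := Module.Finite.iff_fg.2 hL
  exact .middle L.injective_subtype L.mkQ_surjective (LinearMap.exact_subtype_mkQ L)
    (.of_finite _) hA

end ShortExact

lemma Ideal.extFinite_zero_iff (T : Type u) [AddCommGroup T] [Module R T] :
    a.ExtFinite T 0 ↔ Module.Finite R ((R ⧸ a) →ₗ[R] T) := by
  let e : Ext (ModuleCat.of R (R ⧸ a)) (ModuleCat.of R T) 0 ≃ₗ[R] ((R ⧸ a) →ₗ[R] T) :=
    Ext.linearEquiv₀.trans ModuleCat.homLinearEquiv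
  exact Module.Finite.equiv_iff e

lemma Ideal.ExtFinite.torsionBySet_fg {a : Ideal R} {T : Type u} [AddCommGroup T] [Module R T]
    (h : a.ExtFinite T 0) : (Submodule.torsionBySet R T (a : Set R)).FG := by
  have := (a.extFinite_zero_iff T).1 h
  have hr : LinearMap.range (LinearMap.applyₗ (R := R) (M₂ := T) (1 : R ⧸ a)) =
      Submodule.torsionBySet R T (a : Set R) := by
    ext t
    rw [Submodule.mem_torsionBySet_iff]
    constructor
    · rintro ⟨g, rfl⟩ x
      exact Ideal.Quotient.smul_linearMap_one g x.2
    · intro ht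
      refine ⟨a.liftQ (LinearMap.toSpanSingleton R T t) fun x hx ↦ ht ⟨x, hx⟩, ?_⟩
      exact one_smul R t
  rw [← hr]
  exact Module.Finite.iff_fg.1 inferInstance

lemma Ideal.extFinite_zero_of_powTorsion_eq_bot {T : Type u} [AddCommGroup T] [Module R T]
    (h : Submodule.powTorsion a T = ⊥) : a.ExtFinite T 0 := by
  rw [extFinite_zero_iff]
  have : Subsingleton ((R ⧸ a) →ₗ[R] T) := by
    refine subsingleton_of_forall_eq 0 fun g ↦ Ideal.Quotient.linearMap_eq_zero g ?_
    rw [← Submodule.mem_bot R, ← h]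
    exact ⟨1, fun x hx ↦ Ideal.Quotient.smul_linearMap_one g (by simpa using hx)⟩
  infer_instance

lemma Ideal.extFinite_succ_of_injective {T : Type u} [AddCommGroup T] [Module R T]
    [Module.Injective R T] (j : ℕ) : a.ExtFinite T (j + 1) := by
  have : Injective (ModuleCat.of R T) :=
    (Module.injective_iff_injective_object R _).1 inferInstance
  have := Ext.subsingleton_of_injective (ModuleCat.of R (R ⧸ a)) (ModuleCat.of R T) j
  exact inferInstanceAs (Module.Finite R (Ext (ModuleCat.of R (R ⧸ a)) (ModuleCat.of R T) (j + 1)))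

lemma Ideal.smul_ext_eq_zero {x : R} (hx : x ∈ a) {Y : ModuleCat.{u} R} {j : ℕ}
    (e : Ext (ModuleCat.of R (R ⧸ a)) Y j) : x • e = 0 := by
  have h0 : x • 𝟙 (ModuleCat.of R (R ⧸ a)) = 0 := by
    ext
    exact (Ideal.Quotient.smul_linearMap_one (LinearMap.id : (R ⧸ a) →ₗ[R] R ⧸ a) hx)
  rw [← Ext.mk₀_id_comp e, ← Ext.smul_comp, ← Ext.mk₀_smul, h0, Ext.mk₀_zero, Ext.zero_comp]

/-- Factor multiplication by x as T → xT → T, inducing α and β on Ext^j. Since x kills Ext(R/a, T),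
α lands in ker β, which is zero or an image of Ext^(j-1)(R/a, T/xT); ker α is an image of Ext^j of
the kernel of x. -/
theorem Ideal.ExtFinite.of_ker_of_quotient [IsNoetherianRing R] {a : Ideal R} {T : Type u}
    [AddCommGroup T] [Module R T] {x : R} (hx : x ∈ a)
    (h₁ : ∀ j, a.ExtFinite (LinearMap.ker (LinearMap.lsmul R T x)) j)
    (h₂ : ∀ j, a.ExtFinite (T ⧸ LinearMap.range (LinearMap.lsmul R T x)) j) (j : ℕ) :
    a.ExtFinite T j := by
  let φ := LinearMap.lsmul R T x
  let X := ModuleCat.of R (R ⧸ a)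
  let α : Ext X (ModuleCat.of R T) j →ₗ[R] Ext X (ModuleCat.of R (LinearMap.range φ)) j :=
    (Ext.mk₀ (ModuleCat.ofHom φ.rangeRestrict)).postcompOfLinear R X (add_zero j)
  let β : Ext X (ModuleCat.of R (LinearMap.range φ)) j →ₗ[R] Ext X (ModuleCat.of R T) j :=
    (Ext.mk₀ (ModuleCat.ofHom (LinearMap.range φ).subtype)).postcompOfLinear R X (add_zero j)
  have hβα : β ∘ₗ α = 0 := by
    ext e
    refine (Ext.comp_assoc_of_third_deg_zero e (Ext.mk₀ (ModuleCat.ofHom φ.rangeRestrict))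
      (Ext.mk₀ (ModuleCat.ofHom (LinearMap.range φ).subtype)) (add_zero j)).trans ?_
    rw [Ext.mk₀_comp_mk₀]
    have : ModuleCat.ofHom φ.rangeRestrict ≫ ModuleCat.ofHom (LinearMap.range φ).subtype =
        x • 𝟙 (ModuleCat.of R T) := by
      ext t
      rfl
    rw [this, ← Ext.smul_eq_comp_mk₀]
    exact a.smul_ext_eq_zero hx e
  have hS₁ := ModuleCat.shortExact_of_exact (f := (LinearMap.ker φ).subtype)
    (g := φ.rangeRestrict) Subtype.val_injective φ.surjective_rangeRestrict (by
      rw [LinearMap.exact_iff, LinearMap.ker_rangeRestrict, Submodule.range_subtype])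
  have hS₂ := (LinearMap.range φ).shortExact_mkQ
  have hker : Module.Finite R (LinearMap.ker β) := by
    cases j with
    | zero =>
      have : Mono (ModuleCat.ofHom (LinearMap.range φ).subtype) :=
        (ModuleCat.mono_iff_injective _).2 Subtype.val_injective
      have hb : LinearMap.ker β = ⊥ := LinearMap.ker_eq_bot.2
        (Ext.postcomp_mk₀_injective_of_mono X (ModuleCat.ofHom (LinearMap.range φ).subtype))
      rw [hb]
      infer_instance
    | succ j =>
      have hex : Function.Exact (hS₂.extClass.postcompOfLinear R X rfl) β :=
        (ShortComplex.ab_exact_iff_function_exact _).1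
          (Ext.covariant_sequence_exact₁' X hS₂ j (j + 1) rfl)
      rw [hex.linearMap_ker_eq]
      have : Module.Finite R (Ext X (ModuleCat.of R (T ⧸ LinearMap.range φ)) j) := h₂ j
      infer_instance
  refine .of_function_exact
    ((Ext.mk₀ (ModuleCat.ofHom (LinearMap.ker φ).subtype)).postcompOfLinear R X (add_zero j))
    (LinearMap.codRestrict (LinearMap.ker β) α fun e ↦ congr($hβα e)) ?_ (h₁ j) hker
  rw [LinearMap.exact_iff, LinearMap.ker_codRestrict]
  have hex : Function.Exact ((Ext.mk₀ (ModuleCat.ofHom (LinearMap.ker φ).subtype)).postcompOfLinear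
      R X (add_zero j)) α :=
    (ShortComplex.ab_exact_iff_function_exact _).1 (Ext.covariant_sequence_exact₂' X hS₁ j)
  exact hex.linearMap_ker_eq

end ExtFinite

end

/-! ### Supports and associated primes of torsion modules. -/

section Support

variable {R : Type u} [CommRing R] {a : Ideal R} {T : Type v} [AddCommGroup T] [Module R T]

/-- If p is the annihilator of v, it contains a power of `a`, hence `a`; so v is itself `a`-torsion.
-/
lemma Ideal.IsPowTorsion.associatedPrimes_subset [IsNoetherianRing R] (hT : a.IsPowTorsion T) :
    associatedPrimes R T ⊆ associatedPrimes R (Submodule.torsionBySet R T (a : Set R)) := by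
  intro p hp
  obtain ⟨hprime, v, hv⟩ := isAssociatedPrime_iff.1 hp
  have hmem : ∀ x, x ∈ p ↔ x • v = 0 := fun x ↦ by
    rw [hv, Submodule.mem_colon_singleton, Submodule.mem_bot]
  obtain ⟨n, hn⟩ := hT v
  have hap : a ≤ p := hprime.le_of_pow_le fun x hx ↦ (hmem x).2 (hn x hx)
  refine isAssociatedPrime_iff.2 ⟨hprime, ⟨v, ?_⟩, ?_⟩
  · rw [Submodule.mem_torsionBySet_iff]
    exact fun x ↦ (hmem x).1 (hap x.2)
  · ext x
    rw [hmem, Submodule.mem_colon_singleton, Submodule.mem_bot, ← Subtype.coe_inj]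
    rfl

lemma Ideal.IsPowTorsion.finite_associatedPrimes [IsNoetherianRing R] (hT : a.IsPowTorsion T)
    (h : (Submodule.torsionBySet R T (a : Set R)).FG) : (associatedPrimes R T).Finite := by
  have : Module.Finite R (Submodule.torsionBySet R T (a : Set R)) := Module.Finite.iff_fg.2 h
  exact (associatedPrimes.finite R _).subset hT.associatedPrimes_subset

lemma mem_associatedPrimes_of_minimal_mem_support [IsNoetherianRing R] {p : PrimeSpectrum R}
    (hp : p ∈ Module.support R T) (hmin : ∀ q ∈ Module.support R T, q ≤ p → q = p) :
    p.asIdeal ∈ associatedPrimes R T := by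
  obtain ⟨v, hv⟩ := Module.mem_support_iff_exists_annihilator.1 hp
  refine associatedPrimes.subset_of_injective (Submodule.injective_subtype (Submodule.span R {v}))
    (Module.associatedPrimes.minimalPrimes_annihilator_subset_associatedPrimes R _ ?_)
  refine ⟨⟨p.2, hv⟩, fun q ⟨hq, hvq⟩ hqp ↦ ?_⟩
  exact (congrArg PrimeSpectrum.asIdeal
    (hmin ⟨q, hq⟩ (Module.mem_support_iff_exists_annihilator.2 ⟨v, hvq⟩) hqp)).ge

lemma Ideal.IsPowTorsion.exists_mem_and_fg_of_subset_minimal [IsNoetherianRing R]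
    (hT : a.IsPowTorsion T) (hfg : (Submodule.torsionBySet R T (a : Set R)).FG)
    {P : Set (PrimeSpectrum R)} (hPT : P ⊆ Module.support R T)
    (hP : ∀ p ∈ P, ∀ q ∈ Module.support R T, q ≤ p → q = p) :
    ∃ x ∈ a, ∃ L : Submodule R T, L.FG ∧ ∀ p ∈ P,
      p ∉ Module.support R ((T ⧸ L) ⧸ LinearMap.range (LinearMap.lsmul R (T ⧸ L) x)) := by
  have hPf : P.Finite := by
    refine Set.Finite.of_finite_image (f := PrimeSpectrum.asIdeal)
      ((hT.finite_associatedPrimes hfg).subset ?_) fun _ _ _ _ h ↦ PrimeSpectrum.ext h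
    rintro _ ⟨p, hp, rfl⟩
    exact mem_associatedPrimes_of_minimal_mem_support (hPT hp) (hP p hp)
  obtain ⟨x, hx, L, hL, h⟩ := exists_mem_and_fg_forall_notMem_support hT hfg hPf hP
  refine ⟨x, hx, L, hL, fun p hp hps ↦ h p hp ?_⟩
  let N := LinearMap.range (LinearMap.lsmul R (T ⧸ L) x)
  have hle : L ⊔ (⊤ : Submodule R T).map (LinearMap.lsmul R T x) ≤
      LinearMap.ker (N.mkQ ∘ₗ L.mkQ) := by
    refine sup_le (fun t ht ↦ ?_) ?_
    · have h0 : L.mkQ t = 0 := (Submodule.Quotient.mk_eq_zero L).2 ht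
      rw [LinearMap.mem_ker, LinearMap.comp_apply, h0, map_zero]
    · rintro _ ⟨t, -, rfl⟩
      exact (Submodule.Quotient.mk_eq_zero N).2 ⟨L.mkQ t, rfl⟩
  refine Module.support_subset_of_surjective (Submodule.liftQ _ (N.mkQ ∘ₗ L.mkQ) hle) ?_ hps
  rw [← LinearMap.range_eq_top, Submodule.range_liftQ, LinearMap.range_eq_top]
  exact N.mkQ_surjective.comp L.mkQ_surjective

lemma IsArtinian.isMaximal_of_mem_support [IsArtinian R T] {p : PrimeSpectrum R}
    (hp : p ∈ Module.support R T) : p.asIdeal.IsMaximal := by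
  obtain ⟨v, hv⟩ := Module.mem_support_iff_exists_annihilator.1 hp
  let f := LinearMap.toSpanSingleton R T v
  have hker : LinearMap.ker f ≤ p.asIdeal := fun x hx ↦
    hv ((Submodule.mem_annihilator_span_singleton _ _).2 hx)
  have : IsArtinian R (R ⧸ LinearMap.ker f) :=
    isArtinian_of_injective (f.quotKerEquivRange.toLinearMap) f.quotKerEquivRange.injective
  have : IsArtinian R (R ⧸ p.asIdeal) :=
    isArtinian_of_surjective _ (Submodule.factor hker) (Submodule.factor_surjective hker)
  have : IsArtinianRing (R ⧸ p.asIdeal) := isArtinian_of_tower R this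
  exact Ideal.Quotient.maximal_of_isField _ (IsArtinianRing.isField_of_isDomain _)

lemma not_lt_of_supportDim_lt_two (h : Module.supportDim R T < (2 : ℕ))
    {q p m : PrimeSpectrum R} (hq : q ∈ Module.support R T) (hp : p ∈ Module.support R T)
    (hm : m ∈ Module.support R T) (hqp : q < p) : ¬ p < m := by
  intro hpm
  let s : LTSeries (Module.support R T) :=
    ⟨2, ![⟨q, hq⟩, ⟨p, hp⟩, ⟨m, hm⟩], fun i ↦ by fin_cases i; exacts [hqp, hpm]⟩
  exact (h.trans_le (Order.LTSeries.length_le_krullDim s)).false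

lemma smul_ker_lsmul_eq_zero {J : Ideal R} {x : R} (hJ : ∀ y ∈ J, ∀ t : T, y • t = 0) :
    ∀ y ∈ J ⊔ Ideal.span {x}, ∀ t : LinearMap.ker (LinearMap.lsmul R T x), y • t = 0 := by
  intro y hy t
  obtain ⟨y, hyJ, z, hz, rfl⟩ := Submodule.mem_sup.1 hy
  obtain ⟨c, rfl⟩ := Ideal.mem_span_singleton'.1 hz
  have hxt : x • (t : T) = 0 := t.2
  refine Subtype.ext ?_
  rw [Submodule.coe_smul, add_smul, hJ y hyJ, mul_smul, hxt, smul_zero, zero_add,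
    Submodule.coe_zero]

/-- Away from the support of bT/L, each b·t falls into L after multiplication by a single
denominator, because b is finitely generated. -/
lemma Module.support_quotient_torsionBySet_subset {b : Ideal R} (hb : b.FG)
    {L : Submodule R (b • ⊤ : Submodule R T)} :
    let L₁ := L.map (Submodule.subtype _)
    Module.support R ((T ⧸ L₁) ⧸ Submodule.torsionBySet R (T ⧸ L₁) (b : Set R)) ⊆
      Module.support R ((b • ⊤ : Submodule R T) ⧸ L) := by
  intro L₁ p hp
  contrapose! hp
  rw [Module.notMem_support_iff'] at hp ⊢
  intro z
  obtain ⟨z, rfl⟩ := Submodule.mkQ_surjective _ z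
  obtain ⟨t, rfl⟩ := L₁.mkQ_surjective z
  obtain ⟨u, hu, h⟩ := exists_mul_smul_eq_zero_of_fg p.asIdeal b (t := L₁.mkQ t) hb fun x hx ↦ by
    obtain ⟨r, hr, e⟩ := hp (L.mkQ ⟨x • t, Submodule.smul_mem_smul hx trivial⟩)
    refine ⟨r, hr, ?_⟩
    rw [← map_smul, Submodule.mkQ_apply, Submodule.Quotient.mk_eq_zero] at e
    rw [← map_smul, ← map_smul, Submodule.mkQ_apply, Submodule.Quotient.mk_eq_zero]
    exact ⟨_, e, rfl⟩
  refine ⟨u, hu, ?_⟩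
  rw [← map_smul, Submodule.mkQ_apply, Submodule.Quotient.mk_eq_zero,
    Submodule.mem_torsionBySet_iff]
  exact fun x ↦ h x x.2

end Support

/-! ### Cofiniteness in dimensions zero and one. -/

section Cofinite

variable {R : Type u} [CommRing R] [IsNoetherianRing R] {a : Ideal R}

/-- Noetherian induction on an ideal J killing T. Every prime of the support is minimal there, so x
can be chosen with T/L = x(T/L). If x ∈ J then T/L = 0; otherwise the kernel of x is killed by the
larger ideal J + (x). -/
lemma Ideal.ExtFinite.of_support_subset_maximal_aux (J : Ideal R) (T : Type u) [AddCommGroup T]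
    [Module R T] (hT : a.IsPowTorsion T) (hJ : ∀ y ∈ J, ∀ t : T, y • t = 0)
    (hmax : ∀ p ∈ Module.support R T, p.asIdeal.IsMaximal) (h₀ : a.ExtFinite T 0) (j : ℕ) :
    a.ExtFinite T j := by
  induction J using WellFoundedGT.induction generalizing T j with
  | ind J ih =>
  obtain ⟨x, hx, L, hL, hs⟩ := hT.exists_mem_and_fg_of_subset_minimal h₀.torsionBySet_fg subset_rfl
    fun p hp q hq hqp ↦ PrimeSpectrum.ext ((hmax q hq).eq_of_le p.2.ne_top hqp)
  have hsub : Subsingleton ((T ⧸ L) ⧸ LinearMap.range (LinearMap.lsmul R (T ⧸ L) x)) := by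
    rw [← Module.support_eq_empty_iff (R := R), Set.eq_empty_iff_forall_notMem]
    exact fun p hp ↦ hs p (Module.support_subset_of_surjective _ L.mkQ_surjective
      (Module.support_subset_of_surjective _ (Submodule.mkQ_surjective _) hp)) hp
  have hJL : ∀ y ∈ J, ∀ t : T ⧸ L, y • t = 0 := fun y hy t ↦ by
    obtain ⟨t, rfl⟩ := L.mkQ_surjective t
    rw [← map_smul, hJ y hy, map_zero]
  refine .of_quotient_of_fg hL (.of_ker_of_quotient hx (fun j ↦ ?_)
    (fun j ↦ .of_subsingleton j) j)
  by_cases hxJ : x ∈ J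
  · have : Subsingleton (T ⧸ L) := by
      have h0 : LinearMap.range (LinearMap.lsmul R (T ⧸ L) x) = ⊥ := by
        rw [LinearMap.range_eq_bot]
        exact LinearMap.ext (hJL x hxJ)
      rw [Submodule.Quotient.subsingleton_iff, h0] at hsub
      exact (Submodule.subsingleton_iff R).1 (subsingleton_of_bot_eq_top hsub)
    exact .of_subsingleton j
  · set K := LinearMap.ker (LinearMap.lsmul R (T ⧸ L) x)
    have hlt : J ⊔ Ideal.span {x} > J := left_lt_sup.2 (by simpa using hxJ)
    refine ih _ hlt K ((hT.of_surjective _ L.mkQ_surjective).of_injective _ K.injective_subtype)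
      ?_ ?_ (.of_injective K.injective_subtype (h₀.quotient_of_fg hL)) j
    · exact smul_ker_lsmul_eq_zero hJL
    · exact fun p hp ↦ hmax p (Module.support_subset_of_surjective _ L.mkQ_surjective
        (Module.support_subset_of_injective _ K.injective_subtype hp))

/-- An `a`-torsion module of dimension zero is `a`-cofinite as soon as `Hom(R/a, T)` is
finitely generated. -/
theorem Ideal.ExtFinite.of_support_subset_maximal {T : Type u} [AddCommGroup T] [Module R T]
    (hT : a.IsPowTorsion T) (hmax : ∀ p ∈ Module.support R T, p.asIdeal.IsMaximal)
    (h₀ : a.ExtFinite T 0) (j : ℕ) : a.ExtFinite T j :=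
  of_support_subset_maximal_aux ⊥ T hT (fun y hy t ↦ by rw [(Submodule.mem_bot R).1 hy, zero_smul])
    hmax h₀ j

lemma Ideal.ExtFinite.of_support_not_lt_lt_aux (J : Ideal R) (T : Type u) [AddCommGroup T]
    [Module R T] (hT : a.IsPowTorsion T) (hJ : ∀ y ∈ J, ∀ t : T, y • t = 0)
    (hdim : ∀ q ∈ Module.support R T, ∀ p ∈ Module.support R T, ∀ m ∈ Module.support R T,
      q < p → ¬ p < m)
    (h₀ : a.ExtFinite T 0) (h₁ : a.ExtFinite T 1) (j : ℕ) :
    a.ExtFinite T j := by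
  induction J using WellFoundedGT.induction generalizing T j with
  | ind J ih =>
  -- A non-maximal prime of the support is minimal in it, as no chain has three primes; removing all
  -- of these leaves a cokernel of dimension zero.
  obtain ⟨x, hx, L, hL, hs⟩ := hT.exists_mem_and_fg_of_subset_minimal h₀.torsionBySet_fg
    (P := {p ∈ Module.support R T | ¬ p.asIdeal.IsMaximal}) (fun p hp ↦ hp.1) (by
      rintro p ⟨hp, hpm⟩ q hq hqp
      by_contra hne
      obtain ⟨m, hm, hle⟩ := p.asIdeal.exists_le_maximal p.2.ne_top
      have hle' : p ≤ ⟨m, hm.isPrime⟩ := hle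
      refine hdim q hq p hp _ (Module.mem_support_mono hle' hp) (lt_of_le_of_ne hqp hne)
        (lt_of_le_of_ne hle' fun h ↦ hpm ?_)
      rw [h]
      exact hm)
  set φ := LinearMap.lsmul R (T ⧸ L) x with hφ
  have hTL : a.IsPowTorsion (T ⧸ L) := hT.of_surjective _ L.mkQ_surjective
  have hmax : ∀ p ∈ Module.support R ((T ⧸ L) ⧸ LinearMap.range φ), p.asIdeal.IsMaximal := by
    intro p hp
    by_contra hpm
    exact hs p ⟨Module.support_subset_of_surjective _ L.mkQ_surjective
      (Module.support_subset_of_surjective _ (Submodule.mkQ_surjective _) hp), hpm⟩ hp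
  have hJL : ∀ y ∈ J, ∀ t : T ⧸ L, y • t = 0 := fun y hy t ↦ by
    obtain ⟨t, rfl⟩ := L.mkQ_surjective t
    rw [← map_smul, hJ y hy, map_zero]
  have h₀' := h₀.quotient_of_fg hL
  have h₁' := h₁.quotient_of_fg hL
  refine .of_quotient_of_fg hL ?_
  by_cases hxJ : x ∈ J
  · have h0 : LinearMap.range φ = ⊥ := by
      rw [LinearMap.range_eq_bot]
      exact LinearMap.ext (hJL x hxJ)
    have hinj : Function.Injective (LinearMap.range φ).mkQ := by
      rw [← LinearMap.ker_eq_bot, Submodule.ker_mkQ, h0]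
    exact .of_support_subset_maximal hTL
      (fun p hp ↦ hmax p (Module.support_subset_of_injective _ hinj hp)) h₀' j
  · have hlt : J ⊔ Ideal.span {x} > J := left_lt_sup.2 (by simpa using hxJ)
    have hex : Function.Exact (LinearMap.ker φ).subtype φ.rangeRestrict := by
      rw [LinearMap.exact_iff, LinearMap.ker_rangeRestrict, Submodule.range_subtype]
    have hker : ∀ j, a.ExtFinite (LinearMap.ker φ) j := by
      refine ih _ hlt _ (hTL.of_injective _ (Submodule.injective_subtype _)) ?_ ?_
        (.of_injective (Submodule.injective_subtype _) h₀')
        (.left (Submodule.injective_subtype _) φ.surjective_rangeRestrict hex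
          (.of_injective (Submodule.injective_subtype _) h₀') h₁')
      · exact smul_ker_lsmul_eq_zero hJL
      · have hsub : Module.support R (LinearMap.ker φ) ⊆ Module.support R T :=
          (Module.support_subset_of_injective _ (Submodule.injective_subtype _)).trans
            (Module.support_subset_of_surjective _ L.mkQ_surjective)
        exact fun q hq p hp m hm ↦ hdim q (hsub hq) p (hsub hp) m (hsub hm)
    -- The kernel is already known to be finite in every degree; its Ext^2 controls Ext^1 of the
    -- image, which in turn gives Hom(R/a, -) of the cokernel.
    have hrange : a.ExtFinite (LinearMap.range φ) 1 :=
      .right (Submodule.injective_subtype _) φ.surjective_rangeRestrict hex h₁' (hker 2)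
    refine .of_ker_of_quotient hx hker (.of_support_subset_maximal
      (hTL.of_surjective _ (Submodule.mkQ_surjective _)) hmax ?_) j
    exact .right (Submodule.injective_subtype _) (Submodule.mkQ_surjective _)
      (LinearMap.exact_subtype_mkQ _) h₀' hrange

/-- An `a`-torsion module of dimension at most one is `a`-cofinite as soon as `Hom(R/a, T)` and
`Ext^1(R/a, T)` are finitely generated. -/
theorem Ideal.ExtFinite.of_supportDim_lt_two {T : Type u} [AddCommGroup T] [Module R T]
    (hT : a.IsPowTorsion T) (hdim : Module.supportDim R T < (2 : ℕ))
    (h₀ : a.ExtFinite T 0) (h₁ : a.ExtFinite T 1) (j : ℕ) : a.ExtFinite T j :=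
  of_support_not_lt_lt_aux ⊥ T hT
    (fun y hy t ↦ by rw [(Submodule.mem_bot R).1 hy, zero_smul])
    (fun _ hq _ hp _ hm ↦ not_lt_of_supportDim_lt_two hdim hq hp hm) h₀ h₁ j

/-- After dividing by L, the `a^t`-torsion is finitely generated; dividing by it too leaves a module
supported inside Supp(`a^t T`/L). -/
theorem Ideal.ExtFinite.of_isInDimensionLT_two {T : Type u} [AddCommGroup T] [Module R T]
    (hT : a.IsPowTorsion T) {t : ℕ}
    (hdim : Module.IsInDimensionLT R (a ^ t • ⊤ : Submodule R T) 2)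
    (h₀ : a.ExtFinite T 0) (h₁ : a.ExtFinite T 1) (j : ℕ) : a.ExtFinite T j := by
  obtain ⟨L, hL, hd⟩ := hdim
  set L₁ := L.map (Submodule.subtype _)
  have hL₁ : L₁.FG := hL.map _
  have hV := Submodule.torsionBySet_pow_fg a (h₀.quotient_of_fg hL₁).torsionBySet_fg t
  refine .of_quotient_of_fg hL₁ (.of_quotient_of_fg hV (.of_supportDim_lt_two
    ((hT.of_surjective _ L₁.mkQ_surjective).of_surjective _ (Submodule.mkQ_surjective _))
    (lt_of_le_of_lt ?_ hd) ((h₀.quotient_of_fg hL₁).quotient_of_fg hV)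
    ((h₁.quotient_of_fg hL₁).quotient_of_fg hV) j))
  have hsub := Module.support_quotient_torsionBySet_subset (T := T)
    (IsNoetherian.noetherian (a ^ t)) (L := L)
  exact Order.krullDim_le_of_strictMono (Set.inclusion hsub) fun _ _ h ↦ h

end Cofinite

/-! ### Induction on the cohomological degree and conclusion. -/

section Main

variable {R : Type u} [CommRing R]

lemma Module.IsInDimensionLT.of_equiv {M M' : Type v} [AddCommGroup M] [Module R M]
    [AddCommGroup M'] [Module R M'] (e : M ≃ₗ[R] M') {n : ℕ} (h : Module.IsInDimensionLT R M n) :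
    Module.IsInDimensionLT R M' n := by
  obtain ⟨L, hL, hd⟩ := h
  refine ⟨L.map e.toLinearMap, hL.map _, ?_⟩
  rwa [← Module.supportDim_eq_of_equiv (Submodule.Quotient.equiv L _ e rfl)]

lemma Module.IsInDimensionLT.smul_top_of_equiv {M M' : Type v} [AddCommGroup M] [Module R M]
    [AddCommGroup M'] [Module R M'] (e : M ≃ₗ[R] M') (b : Ideal R) {n : ℕ}
    (h : Module.IsInDimensionLT R (b • ⊤ : Submodule R M) n) :
    Module.IsInDimensionLT R (b • ⊤ : Submodule R M') n := by
  have hmap : (b • ⊤ : Submodule R M).map e.toLinearMap = b • ⊤ := by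
    rw [Submodule.map_smul'', Submodule.map_top, LinearEquiv.range]
  exact hmap ▸ h.of_equiv (e.submoduleMap _)

variable [IsNoetherianRing R] (a : Ideal R)

lemma Ideal.ExtFinite.powTorsion_zero {a : Ideal R} {M : Type u} [AddCommGroup M] [Module R M]
    (h : a.ExtFinite M 0) : a.ExtFinite (Submodule.powTorsion a M) 0 :=
  .of_injective (Submodule.injective_subtype _) h

lemma Ideal.ExtFinite.powTorsion_one {a : Ideal R} {M : Type u} [AddCommGroup M] [Module R M]
    (h : a.ExtFinite M 1) : a.ExtFinite (Submodule.powTorsion a M) 1 :=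
  .left (Submodule.injective_subtype _) (Submodule.mkQ_surjective _)
    (LinearMap.exact_subtype_mkQ _)
    (a.extFinite_zero_of_powTorsion_eq_bot (Submodule.powTorsion_quotient_eq_bot a M)) h

/-- If `Ext^j(R/a, M)` is finitely generated for all `j` and `a^t H^i_a(M)` is in dimension `< 2`
for all `i < r`, then `H^r_a(M)` is `a`-torsion and `Hom(R/a, H^r_a(M))` and
`Ext^1(R/a, H^r_a(M))` are finitely generated. -/
theorem localCohomologyModule_extFinite (t r : ℕ) (M : Type u) [AddCommGroup M] [Module R M]
    (hM : ∀ j, a.ExtFinite M j)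
    (h : ∀ i < r, Module.IsInDimensionLT R
      (a ^ t • ⊤ : Submodule R (localCohomologyModule a i M)) 2) :
    a.IsPowTorsion (localCohomologyModule a r M) ∧
      a.ExtFinite (localCohomologyModule a r M) 0 ∧
      a.ExtFinite (localCohomologyModule a r M) 1 := by
  -- M must vary: the cokernel that replaces it need not be finitely generated, but keeps all its
  -- Ext modules finitely generated.
  induction r generalizing M with
  | zero =>
    obtain ⟨e⟩ := nonempty_localCohomologyModule_zero_equiv a M
    exact ⟨Ideal.IsPowTorsion.of_injective Submodule.isPowTorsion_powTorsion e.toLinearMap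
      e.injective, (hM 0).powTorsion_zero.of_equiv e.symm, (hM 1).powTorsion_one.of_equiv e.symm⟩
  | succ r ih =>
    obtain ⟨e⟩ := nonempty_localCohomologyModule_zero_equiv a M
    let G := Submodule.powTorsion a M
    have hGj : ∀ j, a.ExtFinite G j := .of_isInDimensionLT_two Submodule.isPowTorsion_powTorsion
      ((h 0 r.succ_pos).smul_top_of_equiv e _) (hM 0).powTorsion_zero (hM 1).powTorsion_one
    have hQ : ∀ j, a.ExtFinite (M ⧸ G) j := fun j ↦ .right G.injective_subtype G.mkQ_surjective
      (LinearMap.exact_subtype_mkQ G) (hM j) (hGj (j + 1))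
    obtain ⟨E, _, _, f, hE, hf, hE₀, hshift⟩ := exists_localCohomology_shift a M
    have hEj : ∀ j, a.ExtFinite E j
      | 0 => a.extFinite_zero_of_powTorsion_eq_bot hE₀
      | j + 1 => a.extFinite_succ_of_injective j
    have hC : ∀ j, a.ExtFinite (E ⧸ LinearMap.range f) j := fun j ↦
      .right hf (Submodule.mkQ_surjective _) (LinearMap.exact_map_mkQ_range f) (hEj j) (hQ (j + 1))
    obtain ⟨e'⟩ := hshift r
    obtain ⟨hT, h₀, h₁⟩ := ih (E ⧸ LinearMap.range f) hC fun i hi ↦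
      (h (i + 1) (Nat.succ_lt_succ hi)).smul_top_of_equiv (hshift i).some _
    exact ⟨hT.of_injective e'.toLinearMap e'.injective, h₀.of_equiv e'.symm, h₁.of_equiv e'.symm⟩

end Main

theorem theorem3p6 {R : Type u} [CommRing R] [IsNoetherianRing R] (a : Ideal R)
    (M : Type u) [AddCommGroup M] [Module R M] [Module.Finite R M] (r : ℕ)
    (h : ∃ t : ℕ, ∀ i < r, Module.IsInDimensionLT R
      (a ^ t • ⊤ : Submodule R (localCohomologyModule a i M)) 2)
    (N : Submodule R (localCohomologyModule a r M)) (hN : Module.IsMinimax R N) :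
    Module.Finite R ((R ⧸ a) →ₗ[R] (localCohomologyModule a r M ⧸ N)) ∧
      (associatedPrimes R (localCohomologyModule a r M ⧸ N)).Finite := by
  obtain ⟨t, h⟩ := h
  obtain ⟨hT, h₀, h₁⟩ := localCohomologyModule_extFinite a t r M (fun j ↦ .of_finite j) h
  obtain ⟨L, hL, _⟩ := hN
  have hN₀ : a.ExtFinite N 0 := .of_injective N.injective_subtype h₀
  -- The quotient N/L is Artinian, so its support consists of maximal ideals and the dimension zero
  -- criterion applies.
  have hN₁ : a.ExtFinite N 1 := .of_quotient_of_fg hL (.of_support_subset_maximal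
    ((hT.of_injective _ N.injective_subtype).of_surjective _ L.mkQ_surjective)
    (fun _ ↦ IsArtinian.isMaximal_of_mem_support) (hN₀.quotient_of_fg hL) 1)
  have hQ : a.ExtFinite (localCohomologyModule a r M ⧸ N) 0 :=
    .right N.injective_subtype N.mkQ_surjective (LinearMap.exact_subtype_mkQ N) h₀ hN₁
  exact ⟨(a.extFinite_zero_iff _).1 hQ,
    (hT.of_surjective _ N.mkQ_surjective).finite_associatedPrimes hQ.torsionBySet_fg⟩
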